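/- Setting. Let $m\in\mathbb N$ and $d\in\mathbb N$, and let $\mathcal X$ be a measurable space. Client $k\in\{1,\dots,m\}$ has a nonempty compact feasible set $S_k\subset\mathbb R^d$ with Euclidean diameter $D_k$, a measurable oracle $w_k^\star:\mathbb R^d\to S_k$ with $w_k^\star(c)\in\arg\min_{w\in S_k}c^\top w$ for every $c$, and a probability distribution $P_k$ on $\mathcal X\times\mathbb R^d$ under which the cost vector $c$ lies almost surely in a bounded set $\mathcal C\subset\mathbb R^d$. The SPO+ loss is $$\ell_{S_k}(\hat c,c)=\max_{w\in S_k}\{c^\top w-2\hat c^\top w\}+2\hat c^\top w_k^\star(c)-\min_{w\in S_k}c^\top w .$$ Client $k$ holds $n_k$ i.i.d. samples $(x_{k,i},c_{k,i})$ from $P_k$, and the samples of all clients are jointly independent; $N=\sum_k n_k$ and $\alpha_k=n_k/N$. Let $\mathcal H$ be a class of measurable predictors $g:\mathcal X\to\mathbb R^d$ with $\sup_{g\in\mathcal H,\,x\in\mathcal X}\|g(x)\|_2<\infty$, which is pointwise measurable: some countable $\mathcal H_0\subseteq\mathcal H$ is such that every $g\in\mathcal H$ is the pointwise limit of a sequence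 in $\mathcal H_0$ (so that suprema over $\mathcal H$ are measurable). Put $$R_k(g)=\mathbb E_{(x,c)\sim P_k}\,\ell_{S_k}(g(x),c),\quad R_{\rm mix}=\sum_k\alpha_kR_k,\quad \Delta_j=\sup_{g\in\mathcal H}|R_j(g)-R_{\rm mix}(g)|,$$ $$\widehat R_k(g)=\frac1{n_k}\sum_{i=1}^{n_k}\ell_{S_k}(g(x_{k,i}),c_{k,i}),\qquad \widehat R_{\rm mix}(g)=\frac1N\sum_{k=1}^m\sum_{i=1}^{n_k}\ell_{S_k}(g(x_{k,i}),c_{k,i}).$$ For $n$ independent covariates $x_1,\dots,x_n$ and independent Rademacher signs $\sigma_{il}$, independent of the covariates, let $$\mathfrak R_n(\mathcal H)=\mathbb E\Big[\sup_{g\in\mathcal H}\frac1n\sum_{i=1}^n\sum_{l=1}^d\sigma_{il}\,g_l(x_i)\Big];$$ in $\mathfrak R_{n_j}(\mathcal H)$ below the covariates are those of client $j$'s sample, and in $\mathfrak R_N(\mathcal H)$ those of the pooled sample (if all clients share one covariate distribution $P_X$, they are i.i.d. from $P_X$ in both cases). With $b_k=\sup\{\ell_{S_k}(g(x),c):g\in\mathcal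 H,\,x\in\mathcal X,\,c\in\mathcal C\}$, $D_{\max}=\max_kD_k$ and $b_{\max}=\max_kb_k$, put $$\varepsilon_j(n_j,\delta)=4\sqrt2\,D_j\,\mathfrak R_{n_j}(\mathcal H)+b_j\sqrt{\frac{2\log(1/\delta)}{n_j}},\qquad \varepsilon_{\rm mix}(N,\delta)=4\sqrt2\,D_{\max}\,\mathfrak R_N(\mathcal H)+b_{\max}\sqrt{\frac{2\log(1/\delta)}{N}} .$$ Theorem (SPO+ federation gain bound). Fix a client $j$ with $n_j\ge1$, let $g_j^\star\in\arg\min_{g\in\mathcal H}R_j(g)$, and let $\delta\in(0,1)$. With probability at least $1-\delta$ over all data, both of the following hold: every $\hat g_j^{\rm loc}\in\arg\min_{g\in\mathcal H}\widehat R_j(g)$ satisfies $$R_j(\hat g_j^{\rm loc})-R_j(g_j^\star)\le 2\,\varepsilon_j\big(n_j,\tfrac\delta2\big),$$ and every $\hat g^{\rm fed}\in\arg\min_{g\in\mathcal H}\widehat R_{\rm mix}(g)$ satisfies $$R_j(\hat g^{\rm fed})-R_j(g_j^\star)\le 2\,\varepsilon_{\rm mix}\big(N,\tfrac\delta2\big)+2\Delta_j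 .$$ -/

import Mathlib

open MeasureTheory ProbabilityTheory Filter Topology

noncomputable section

namespace FedSPO

/-- Cost vectors, predictions and decisions live in `ℝ^d` with the Euclidean norm. -/
abbrev Vec (d : ℕ) : Type := EuclideanSpace ℝ (Fin d)

/-- Support function `ξ_S(u) = max_{w ∈ S} uᵀ w` (the supremum is attained for nonempty compact
`S`). -/
def supportFun {d : ℕ} (S : Set (Vec d)) (u : Vec d) : ℝ :=
  sSup ((fun w => inner ℝ u w) '' S)

/-- Optimal value `z_S^*(c) = min_{w ∈ S} cᵀ w`. -/
def optValue {d : ℕ} (S : Set (Vec d)) (c : Vec d) : ℝ :=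
  sInf ((fun w => inner ℝ c w) '' S)

/-- `w` is an optimization oracle for `S`: it selects a point of `argmin_{v ∈ S} cᵀ v` for
every cost vector `c`. -/
def IsOracle {d : ℕ} (S : Set (Vec d)) (w : Vec d → Vec d) : Prop :=
  ∀ c, w c ∈ S ∧ ∀ v ∈ S, inner ℝ c (w c) ≤ inner ℝ c v

/-- The SPO+ loss
`ℓ_S(ĉ, c) = max_{v ∈ S} (cᵀ v - 2 ĉᵀ v) + 2 ĉᵀ w^*(c) - z_S^*(c)`, where `w` is the oracle. -/
def spoPlus {d : ℕ} (S : Set (Vec d)) (w : Vec d → Vec d) (chat c : Vec d) : ℝ :=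
  supportFun S (c - (2 : ℝ) • chat) + 2 * inner ℝ chat (w c) - optValue S c

/-- Population SPO+ risk `R(g) = 𝔼_{(x,c) ∼ P} ℓ_S(g(x), c)`. -/
def risk {d : ℕ} {X : Type*} [MeasurableSpace X] (S : Set (Vec d)) (w : Vec d → Vec d)
    (P : Measure (X × Vec d)) (g : X → Vec d) : ℝ :=
  ∫ z, spoPlus S w (g z.1) z.2 ∂P

/-- Empirical SPO+ risk of `g` on the sample `z 0, …, z (n - 1)`. -/
def empRisk {d : ℕ} {X : Type*} (S : Set (Vec d)) (w : Vec d → Vec d)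
    {n : ℕ} (z : Fin n → X × Vec d) (g : X → Vec d) : ℝ :=
  (1 / (n : ℝ)) * ∑ i, spoPlus S w (g (z i).1) (z i).2

/-- Total sample size `N = ∑ n_k`. -/
def totalSize {m : ℕ} (n : Fin m → ℕ) : ℕ := ∑ k, n k

/-- Mixture risk `R_mix(g) = ∑ α_k R_k(g)` with weights `α_k = n_k / N`. -/
def mixRisk {d m : ℕ} {X : Type*} [MeasurableSpace X] (S : Fin m → Set (Vec d))
    (w : Fin m → Vec d → Vec d) (P : Fin m → Measure (X × Vec d)) (n : Fin m → ℕ)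
    (g : X → Vec d) : ℝ :=
  ∑ k, ((n k : ℝ) / (totalSize n : ℝ)) * risk (S k) (w k) (P k) g

/-- Empirical mixture risk: the average, over all `N` pooled samples, of the SPO+ loss of the
client that owns the sample. -/
def mixEmpRisk {d m : ℕ} {X : Type*} (S : Fin m → Set (Vec d))
    (w : Fin m → Vec d → Vec d) {n : Fin m → ℕ} (z : (k : Fin m) → Fin (n k) → X × Vec d)
    (g : X → Vec d) : ℝ :=
  (1 / (totalSize n : ℝ)) * ∑ k, ∑ i, spoPlus (S k) (w k) (g (z k i).1) (z k i).2

/-- Rademacher complexity of a class of vector-valued functions,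
`𝔼 sup_{g ∈ H} (1/n) ∑_i ∑_k σ_{ik} g_k(x_i)`, for independent `x_i ∼ Q i` indexed by a finite
type `ι` with `n` elements, and independent uniform signs `σ_{ik}` (whose expectation is written
as the average over all sign patterns). -/
def rademacher {d : ℕ} {X : Type*} [MeasurableSpace X] {ι : Type} [Fintype ι] [DecidableEq ι]
    (Q : ι → Measure X) (H : Set (X → Vec d)) : ℝ :=
  ∫ x : ι → X,
    (1 / (Fintype.card (ι → Fin d → ℤˣ) : ℝ)) *
      ∑ σ : ι → Fin d → ℤˣ,
        ⨆ g : H, (1 / (Fintype.card ι : ℝ)) *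
          ∑ i, ∑ k, ((σ i k : ℤ) : ℝ) * (g : X → Vec d) (x i) k
    ∂(Measure.pi Q)

/-- `𝔑_n(H)` for `n` i.i.d. covariates drawn from the covariate marginal of `P`. -/
def localRademacher {d : ℕ} {X : Type*} [MeasurableSpace X] (P : Measure (X × Vec d)) (n : ℕ)
    (H : Set (X → Vec d)) : ℝ :=
  rademacher (fun _ : Fin n => P.fst) H

/-- `𝔑_N(H)` for the `N` covariates of the pooled sample, `n_k` of which are drawn from the
covariate marginal of `P_k`. If all clients share the covariate distribution `P_X`, these are
`N` i.i.d. covariates from `P_X`. -/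
def pooledRademacher {d m : ℕ} {X : Type*} [MeasurableSpace X]
    (P : Fin m → Measure (X × Vec d)) (n : Fin m → ℕ) (H : Set (X → Vec d)) : ℝ :=
  rademacher (fun p : (Σ k : Fin m, Fin (n k)) => (P p.1).fst) H

/-- `b = sup { ℓ_S(ĉ, c) : ĉ ∈ H(X), c ∈ C }`. -/
def lossBound {d : ℕ} {X : Type*} (S : Set (Vec d)) (w : Vec d → Vec d)
    (H : Set (X → Vec d)) (C : Set (Vec d)) : ℝ :=
  sSup {r | ∃ g ∈ H, ∃ x : X, ∃ c ∈ C, r = spoPlus S w (g x) c}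

/-- Local complexity term
`ε(n, δ) = 4 √2 D_S 𝔑_n(H) + b √(2 log(1/δ) / n)`. -/
def localEps {d : ℕ} {X : Type*} [MeasurableSpace X] (S : Set (Vec d)) (w : Vec d → Vec d)
    (P : Measure (X × Vec d)) (H : Set (X → Vec d)) (C : Set (Vec d)) (n : ℕ) (δ : ℝ) : ℝ :=
  4 * √2 * Metric.diam S * localRademacher P n H
    + lossBound S w H C * √(2 * Real.log (1 / δ) / (n : ℝ))

/-- Pooled complexity term
`ε_mix(N, δ) = 4 √2 D_max 𝔑_N(H) + b_max √(2 log(1/δ) / N)`, where `D_max` and `b_max` are the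
largest diameter and the largest loss bound among the clients. -/
def mixEps {d m : ℕ} {X : Type*} [MeasurableSpace X] (S : Fin m → Set (Vec d))
    (w : Fin m → Vec d → Vec d) (P : Fin m → Measure (X × Vec d)) (H : Set (X → Vec d))
    (C : Set (Vec d)) (n : Fin m → ℕ) (δ : ℝ) : ℝ :=
  4 * √2 * (⨆ k, Metric.diam (S k)) * pooledRademacher P n H
    + (⨆ k, lossBound (S k) (w k) H C) * √(2 * Real.log (1 / δ) / (totalSize n : ℝ))

/-- Client--mixture discrepancy `Δ_j = sup_{g ∈ H} |R_j(g) - R_mix(g)|`. -/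
def discrepancy {d m : ℕ} {X : Type*} [MeasurableSpace X] (S : Fin m → Set (Vec d))
    (w : Fin m → Vec d → Vec d) (P : Fin m → Measure (X × Vec d)) (n : Fin m → ℕ)
    (H : Set (X → Vec d)) (j : Fin m) : ℝ :=
  ⨆ g : H, |risk (S j) (w j) (P j) g - mixRisk S w P n g|

/-- `H` is a pointwise measurable class: its members are measurable, and each of them is the
pointwise limit of a sequence from a fixed countable subclass. This is the usual condition under
which suprema over `H` are measurable functions of the sample. -/
def PointwiseMeasurable {d : ℕ} {X : Type*} [MeasurableSpace X] (H : Set (X → Vec d)) : Prop :=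
  (∀ g ∈ H, Measurable g) ∧
    ∃ H₀ ⊆ H, H₀.Countable ∧ ∀ g ∈ H, ∃ u : ℕ → X → Vec d,
      (∀ r, u r ∈ H₀) ∧ ∀ x, Tendsto (fun r => u r x) atTop (𝓝 (g x))

end FedSPO

end

/-! An empirical minimiser `ĝ` has empirical risk no larger than that of `g*`. Its excess risk is
therefore at most the deviation (risk minus empirical risk) at `ĝ` minus the deviation at `g*`. It
suffices to bound the supremum over the class of this relative one-sided deviation. The term at `g*`
has mean zero, so it costs nothing in expectation and only doubles the bounded differences, from `b`
to `2b`.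

The expectation is bounded by symmetrization (factor 2, `integral_ciSup_deviation_le`) followed by a
vector contraction (factor `2√2 L`, `mean_ciSup_sum_sign_le`), with `L = 2D` the Lipschitz constant
of the SPO+ loss (`abs_spoPlus_sub_le`). The product `8√2 D` is twice the constant in `ε`. The
contraction rests on an elementary `L¹` Khintchine inequality from second and fourth moments.
Fluctuations are controlled by a bounded differences inequality; `measureReal_deviation_le` combines
the two bounds.

All of this uses independence but not identical distribution, so `exists_uniform_deviation_event`
serves both the sample of client `j` and the pooled sample, each at level `δ/2`. For the pooled
sample it bounds the excess mixture risk; replacing the mixture risk by `R_j` at `ĝ` and at `g*`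
costs `Δ_j` each time. Measurability of suprema comes from a countable pointwise dense subclass,
with a passage to the limit at the end. -/

namespace FedSPO

/-- The average of `f` over a finite type. -/
noncomputable def mean {α : Type*} [Fintype α] (f : α → ℝ) : ℝ := (1 / (Fintype.card α : ℝ)) * ∑ a, f a

/-! ### Averages over finite types and sign patterns -/

section Mean

variable {α β : Type*} [Fintype α] [Fintype β]

lemma mean_mono {f g : α → ℝ} (h : ∀ a, f a ≤ g a) : mean f ≤ mean g :=
  mul_le_mul_of_nonneg_left (Finset.sum_le_sum fun a _ => h a) (by positivity)

lemma mean_add (f g : α → ℝ) : mean (fun a => f a + g a) = mean f + mean g := by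
  simp [mean, Finset.sum_add_distrib, mul_add]

lemma mean_const_mul (c : ℝ) (f : α → ℝ) : mean (fun a => c * f a) = c * mean f := by
  simp only [mean, ← Finset.mul_sum]; ring

lemma mean_const [Nonempty α] (c : ℝ) : mean (fun _ : α => c) = c := by
  simp [mean]

lemma mean_equiv (e : α ≃ β) (f : β → ℝ) : mean (fun a => f (e a)) = mean f := by
  simp [mean, Fintype.card_congr e, Equiv.sum_comp e f]

lemma mean_prod (f : α × β → ℝ) : mean f = mean fun a => mean fun b => f (a, b) := by
  simp only [mean, Fintype.sum_prod_type, Fintype.card_prod, ← Finset.mul_sum]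
  push_cast
  rw [← mul_assoc, one_div_mul_one_div]

lemma mean_comm (f : α → β → ℝ) :
    (mean fun a => mean fun b => f a b) = mean fun b => mean fun a => f a b := by
  rw [← mean_prod fun p : α × β => f p.1 p.2, ← mean_prod fun p : β × α => f p.2 p.1]
  exact mean_equiv (Equiv.prodComm α β) fun p : β × α => f p.2 p.1

lemma mean_fin_succ {n : ℕ} (f : (Fin (n + 1) → α) → ℝ) :
    mean f = mean fun a => mean fun b : Fin n → α => f (Fin.cons a b) := by
  rw [← mean_prod fun p : α × (Fin n → α) => f (Fin.cons p.1 p.2)]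
  exact (mean_equiv (Fin.consEquiv fun _ => α) f).symm

lemma mean_sign (f : ℤˣ → ℝ) : mean f = (f 1 + f (-1)) / 2 := by
  have : (Finset.univ : Finset ℤˣ) = {1, -1} := rfl
  rw [mean, Fintype.card, this, Finset.sum_pair (by decide), Finset.card_pair (by decide)]
  push_cast; ring

end Mean

/-! ### Moments of Rademacher sums and the Khintchine inequality -/

section Khintchine

variable {d : ℕ}

lemma mean_sign_linear_pow_two (v : Fin d → ℝ) :
    (mean fun ε : Fin d → ℤˣ => (∑ k, ((ε k : ℤ) : ℝ) * v k) ^ 2) = ∑ k, v k ^ 2 := by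
  induction d with
  | zero => simp [mean]
  | succ d ih =>
    rw [mean_fin_succ, mean_sign, Fin.sum_univ_succ, ← ih fun k => v k.succ, ← mean_add]
    simp only [Fin.sum_univ_succ, Fin.cons_zero, Fin.cons_succ]
    rw [← mean_const (α := Fin d → ℤˣ) (v 0 ^ 2), ← mean_add, div_eq_inv_mul, ← mean_const_mul]
    congr 1; ext ε; push_cast; ring

/-- Averaging over the first sign kills the odd powers and leaves `v₀⁴ + 6 v₀² Σ` plus the fourth
moment of the rest, where `Σ` is the sum of the other squares. The constant 3 closes the induction:
`3 (v₀² + Σ)²` contains the cross term `6 v₀² Σ` exactly. -/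
lemma mean_sign_linear_pow_four (v : Fin d → ℝ) :
    (mean fun ε : Fin d → ℤˣ => (∑ k, ((ε k : ℤ) : ℝ) * v k) ^ 4) ≤ 3 * (∑ k, v k ^ 2) ^ 2 := by
  induction d with
  | zero => simp [mean]
  | succ d ih =>
    have key : (mean fun ε : Fin (d + 1) → ℤˣ => (∑ k, ((ε k : ℤ) : ℝ) * v k) ^ 4)
        = v 0 ^ 4 + 6 * v 0 ^ 2 * (∑ k : Fin d, v k.succ ^ 2)
          + mean fun ε : Fin d → ℤˣ => (∑ k, ((ε k : ℤ) : ℝ) * v k.succ) ^ 4 := by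
      rw [mean_fin_succ, mean_sign, ← mean_add, ← mean_sign_linear_pow_two fun k => v k.succ,
        ← mean_const_mul, ← mean_const (α := Fin d → ℤˣ) (v 0 ^ 4), ← mean_add, ← mean_add,
        div_eq_inv_mul, ← mean_const_mul]
      simp only [Fin.sum_univ_succ, Fin.cons_zero, Fin.cons_succ]
      congr 1; ext ε; push_cast; ring
    rw [key, Fin.sum_univ_succ]
    nlinarith [ih fun k => v k.succ, sq_nonneg (v 0 ^ 2)]

/-- An `L¹` Khintchine inequality, obtained from the second and fourth moments. -/
lemma norm_le_mean_abs_sign_linear (v : Vec d) :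
    ‖v‖ ≤ 2 * √2 * mean fun ε : Fin d → ℤˣ => |∑ k, ((ε k : ℤ) : ℝ) * v k| := by
  set s := ‖v‖ with hs
  set E := mean fun ε : Fin d → ℤˣ => |∑ k, ((ε k : ℤ) : ℝ) * v k| with hE
  have hE0 : 0 ≤ E := by
    rw [← mean_const (α := Fin d → ℤˣ) (0 : ℝ)]; exact mean_mono fun _ => abs_nonneg _
  have hsq : ∑ k, v k ^ 2 = s ^ 2 := by rw [hs, EuclideanSpace.real_norm_sq_eq]
  have hs0 : 0 ≤ s := norm_nonneg v
  rcases hs0.eq_or_lt with h0 | h0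
  · rw [← h0]; positivity
  -- The even quartic lies below `s³|x|` and touches it at `|x| = 3s/2`; the difference is `|x| (|x|
  -- + 3s) (2|x| - 3s)² / 27`.
  have pt : ∀ x : ℝ, s ^ 2 * x ^ 2 + (-4 / 27) * x ^ 4 ≤ s ^ 3 * |x| := by
    intro x
    have hx := abs_nonneg x
    rw [← sq_abs x, show x ^ 4 = |x| ^ 4 by rw [Even.pow_abs (by decide)]]
    have : 0 ≤ |x| * (|x| + 3 * s) * (2 * |x| - 3 * s) ^ 2 := by positivity
    nlinarith
  have h := mean_mono fun ε : Fin d → ℤˣ => pt (∑ k, ((ε k : ℤ) : ℝ) * v k)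
  rw [mean_add, mean_const_mul, mean_const_mul, mean_const_mul, mean_sign_linear_pow_two, hsq,
    ← hE] at h
  have h4 := mean_sign_linear_pow_four (fun k => v k)
  rw [hsq] at h4
  -- Averaging gives `s⁴ - (4/27) · 3 s⁴ = (5/9) s⁴`, hence `s ≤ (9/5) E`, and `9/5 ≤ 2√2`.
  have h5 : s ^ 3 * (5 / 9 * s) ≤ s ^ 3 * E := by nlinarith
  have h6 := le_of_mul_le_mul_left h5 (by positivity)
  have h7 : (9 / 10 : ℝ) ≤ √2 := Real.le_sqrt_of_sq_le (by norm_num)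
  nlinarith

end Khintchine

/-! ### Vector contraction for Rademacher averages -/

section Contraction

variable {T : Type*} [Nonempty T] {d : ℕ}

lemma abs_sign_linear_le (ε : Fin d → ℤˣ) (v : Vec d) :
    |∑ k, ((ε k : ℤ) : ℝ) * v k| ≤ d * ‖v‖ := by
  refine (Finset.abs_sum_le_sum_abs _ _).trans ?_
  have : ∀ k ∈ Finset.univ, |((ε k : ℤ) : ℝ) * v k| ≤ ‖v‖ := by
    intro k _
    have h1 : |((ε k : ℤ) : ℝ)| = 1 := by
      rcases Int.units_eq_one_or (ε k) with h | h <;> simp [h]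
    rw [abs_mul, h1, one_mul]
    exact PiLp.norm_apply_le v k
  simpa using Finset.sum_le_sum this

/-- Contraction for one sign: a sign in front of a real-valued Lipschitz function of a vector may be
replaced by independent signs in front of the coordinates of the vector. -/
lemma mean_ciSup_sign_le {A h : T → ℝ} {v : T → Vec d} {L MA Mv : ℝ} (hL : 0 ≤ L)
    (hA : ∀ t, |A t| ≤ MA) (hv : ∀ t, ‖v t‖ ≤ Mv)
    (hlip : ∀ t s, |h t - h s| ≤ L * ‖v t - v s‖) :
    (mean fun σ : ℤˣ => ⨆ t, (A t + ((σ : ℤ) : ℝ) * h t)) ≤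
      mean fun ε : Fin d → ℤˣ => ⨆ t, (A t + 2 * √2 * L * ∑ k, ((ε k : ℤ) : ℝ) * v t k) := by
  set c := 2 * √2 * L with hc
  have hc0 : 0 ≤ c := by positivity
  set G : (Fin d → ℤˣ) → ℝ := fun ε => ⨆ t, (A t + c * ∑ k, ((ε k : ℤ) : ℝ) * v t k) with hG
  have hbdd : ∀ ε : Fin d → ℤˣ,
      BddAbove (Set.range fun t => A t + c * ∑ k, ((ε k : ℤ) : ℝ) * v t k) := by
    intro ε
    refine ⟨MA + c * (d * Mv), ?_⟩
    rintro _ ⟨t, rfl⟩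
    have h1 := (le_abs_self _).trans (abs_sign_linear_le ε (v t))
    have h2 : (d : ℝ) * ‖v t‖ ≤ d * Mv := mul_le_mul_of_nonneg_left (hv t) (by positivity)
    exact add_le_add ((le_abs_self _).trans (hA t))
      (mul_le_mul_of_nonneg_left (h1.trans h2) hc0)
  have hneg : mean (fun ε => G (-ε)) = mean G := mean_equiv (Equiv.neg _) G
  -- The two values of the sign are handled with separate maximisers `t` and `s`. The Lipschitz
  -- bound and Khintchine turn `h t - h s` into an average of `|⟨ε, v t - v s⟩|`. For each `ε` the
  -- sign of this inner product decides which of `t`, `s` is charged to `G ε` and which to `G (-ε)`.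
  have key : ∀ t s, A t + h t + (A s - h s) ≤ 2 * mean G := by
    intro t s
    have e1 : A t + h t + (A s - h s)
        ≤ mean fun ε : Fin d → ℤˣ =>
          (A t + A s) + c * |∑ k, ((ε k : ℤ) : ℝ) * (v t - v s) k| := by
      rw [mean_add, mean_const, mean_const_mul]
      have := mul_le_mul_of_nonneg_left (norm_le_mean_abs_sign_linear (v t - v s)) hL
      have := (le_abs_self _).trans (hlip t s)
      rw [hc]; linarith
    have e2 : (mean fun ε : Fin d → ℤˣ =>
          (A t + A s) + c * |∑ k, ((ε k : ℤ) : ℝ) * (v t - v s) k|)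
        ≤ mean fun ε => G ε + G (-ε) := by
      refine mean_mono fun ε => ?_
      have a1 := le_ciSup (hbdd ε) t
      have a2 := le_ciSup (hbdd ε) s
      have a3 := le_ciSup (hbdd (-ε)) t
      have a4 := le_ciSup (hbdd (-ε)) s
      simp only [Pi.neg_apply, Units.val_neg, Int.cast_neg, neg_mul, Finset.sum_neg_distrib]
        at a3 a4
      have hx : ∑ k, ((ε k : ℤ) : ℝ) * (v t - v s) k
          = (∑ k, ((ε k : ℤ) : ℝ) * v t k) - ∑ k, ((ε k : ℤ) : ℝ) * v s k := by
        rw [← Finset.sum_sub_distrib]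
        exact Finset.sum_congr rfl fun k _ => by simp [mul_sub]
      have hG1 : G ε = ⨆ t, (A t + c * ∑ k, ((ε k : ℤ) : ℝ) * v t k) := rfl
      have hG2 : G (-ε) = ⨆ t, (A t + c * -∑ k, ((ε k : ℤ) : ℝ) * v t k) := by
        simp [hG]
      rw [hG1, hG2, hx, mul_comm c, ← abs_of_nonneg hc0, ← abs_mul, abs_of_nonneg hc0]
      rcases abs_cases (((∑ k, ((ε k : ℤ) : ℝ) * v t k) - ∑ k, ((ε k : ℤ) : ℝ) * v s k) * c)
        with ⟨hh, -⟩ | ⟨hh, -⟩ <;> rw [hh] <;> linarith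
    rw [mean_add G fun ε => G (-ε), hneg] at e2
    linarith
  rw [mean_sign]
  simp only [Units.val_one, Int.cast_one, one_mul, Units.val_neg, Int.cast_neg, neg_mul]
  have s1 : (⨆ t, (A t + h t)) ≤ 2 * mean G - ⨆ t, (A t + -h t) := by
    refine ciSup_le fun t => ?_
    have : (⨆ s, (A s + -h s)) ≤ 2 * mean G - (A t + h t) :=
      ciSup_le fun s => by have := key t s; linarith
    linarith
  linarith

/-- Vector contraction inequality for suprema over `n` signs. -/
lemma mean_ciSup_sum_sign_le_fin {n : ℕ} {A : T → ℝ} {h : Fin n → T → ℝ}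
    {v : Fin n → T → Vec d} {L MA Mh Mv : ℝ} (hL : 0 ≤ L)
    (hA : ∀ t, |A t| ≤ MA) (hh : ∀ i t, |h i t| ≤ Mh) (hv : ∀ i t, ‖v i t‖ ≤ Mv)
    (hlip : ∀ i t s, |h i t - h i s| ≤ L * ‖v i t - v i s‖) :
    (mean fun σ : Fin n → ℤˣ => ⨆ t, (A t + ∑ i, ((σ i : ℤ) : ℝ) * h i t)) ≤
      mean fun ε : Fin n → Fin d → ℤˣ =>
        ⨆ t, (A t + 2 * √2 * L * ∑ i, ∑ k, ((ε i k : ℤ) : ℝ) * v i t k) := by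
  induction n generalizing A MA with
  | zero => simp [mean]
  | succ n ih =>
    rw [mean_fin_succ, mean_fin_succ]
    simp only [Fin.sum_univ_succ, Fin.cons_zero, Fin.cons_succ]
    have step1 : ∀ σ₀ : ℤˣ,
        (mean fun σ : Fin n → ℤˣ =>
          ⨆ t, (A t + (((σ₀ : ℤ) : ℝ) * h 0 t + ∑ i, ((σ i : ℤ) : ℝ) * h i.succ t))) ≤
        mean fun ε : Fin n → Fin d → ℤˣ => ⨆ t, ((A t + 2 * √2 * L *
          ∑ i, ∑ k, ((ε i k : ℤ) : ℝ) * v i.succ t k) + ((σ₀ : ℤ) : ℝ) * h 0 t) := by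
      intro σ₀
      have h1 : |((σ₀ : ℤ) : ℝ)| = 1 := by
        rcases Int.units_eq_one_or σ₀ with h | h <;> simp [h]
      -- The offset `A` is carried through the induction so that it can absorb the term of the sign
      -- held fixed.
      have := ih (A := fun t => A t + ((σ₀ : ℤ) : ℝ) * h 0 t) (MA := MA + Mh)
        (h := fun i => h i.succ) (v := fun i => v i.succ)
        (fun t => (abs_add_le _ _).trans
          (add_le_add (hA t) (by rw [abs_mul, h1, one_mul]; exact hh 0 t)))
        (fun i => hh i.succ) (fun i => hv i.succ) (fun i => hlip i.succ)
      simpa only [add_assoc, add_left_comm, add_comm] using this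
    refine (mean_mono step1).trans ?_
    -- With the averages exchanged, the remaining sign is treated for fixed `ε`, the vector sum
    -- already obtained now being part of the offset.
    refine (mean_comm _).trans_le ((mean_mono fun ε => ?_).trans_eq (mean_comm _))
    have hb : ∀ t, |A t + 2 * √2 * L * ∑ i : Fin n, ∑ k, ((ε i k : ℤ) : ℝ) * v i.succ t k|
        ≤ MA + 2 * √2 * L * (n * (d * Mv)) := by
      intro t
      refine (abs_add_le _ _).trans (add_le_add (hA t) ?_)
      rw [abs_mul, abs_of_nonneg (by positivity : 0 ≤ 2 * √2 * L)]
      refine mul_le_mul_of_nonneg_left ?_ (by positivity)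
      refine (Finset.abs_sum_le_sum_abs _ _).trans ?_
      have : ∀ i ∈ (Finset.univ : Finset (Fin n)),
          |∑ k, ((ε i k : ℤ) : ℝ) * v i.succ t k| ≤ d * Mv := fun i _ =>
        (abs_sign_linear_le (ε i) (v i.succ t)).trans
          (mul_le_mul_of_nonneg_left (hv _ _) (by positivity))
      simpa using Finset.sum_le_sum this
    have := mean_ciSup_sign_le hL hb (hv 0) (hlip 0)
    refine this.trans (le_of_eq ?_)
    congr 1; ext ε'; congr 1; ext t; ring

lemma mean_ciSup_sum_sign_le {ι : Type*} [Fintype ι] [DecidableEq ι] {h : ι → T → ℝ}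
    {v : ι → T → Vec d} {L Mh Mv : ℝ} (hL : 0 ≤ L)
    (hh : ∀ i t, |h i t| ≤ Mh) (hv : ∀ i t, ‖v i t‖ ≤ Mv)
    (hlip : ∀ i t s, |h i t - h i s| ≤ L * ‖v i t - v i s‖) :
    (mean fun σ : ι → ℤˣ => ⨆ t, ∑ i, ((σ i : ℤ) : ℝ) * h i t) ≤
      2 * √2 * L * mean fun ε : ι → Fin d → ℤˣ =>
        ⨆ t, ∑ i, ∑ k, ((ε i k : ℤ) : ℝ) * v i t k := by
  let e := Fintype.equivFin ι
  have := mean_ciSup_sum_sign_le_fin (T := T) (A := fun _ => 0) (MA := 0)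
    (h := fun i => h (e.symm i)) (v := fun i => v (e.symm i)) hL (by simp)
    (fun i => hh _) (fun i => hv _) (fun i => hlip _)
  simp only [zero_add] at this
  rw [← mean_equiv (e.arrowCongr (Equiv.refl _)), ← mean_equiv (e.arrowCongr (Equiv.refl _))]
    at this
  simp only [← Real.mul_iSup_of_nonneg (by positivity : 0 ≤ 2 * √2 * L), mean_const_mul] at this
  simp only [← Equiv.sum_comp e, Equiv.arrowCongr_apply, Equiv.coe_refl, Function.comp_apply,
    id_eq, Equiv.symm_apply_apply] at this
  exact this

end Contraction

/-! ### Bounded differences inequality -/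

section McDiarmid

variable {Z : Type*} [MeasurableSpace Z]

lemma integrable_of_bound {α : Type*} [MeasurableSpace α] {ν : Measure α} [IsFiniteMeasure ν]
    {f : α → ℝ} (hf : Measurable f) {M : ℝ} (hM : ∀ x, |f x| ≤ M) : Integrable f ν :=
  Integrable.of_bound hf.aestronglyMeasurable M (ae_of_all _ hM)

lemma abs_integral_le_of_bound {α : Type*} [MeasurableSpace α] {ν : Measure α}
    [IsProbabilityMeasure ν] {f : α → ℝ} {M : ℝ} (hM : ∀ x, |f x| ≤ M) : |∫ x, f x ∂ν| ≤ M := by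
  simpa using norm_integral_le_of_norm_le_const (μ := ν) (f := f) (C := M) (ae_of_all _ hM)

/-- Each value of `f` is within `c` of the mean, so Hoeffding's lemma applies on `[m - c, m + c]`.
The width `2c` gives `c²/2` rather than the sharp `c²/8`, which suffices for the stated confidence
term. -/
lemma integral_exp_le_of_oscillation {ν : Measure Z} [IsProbabilityMeasure ν] {f : Z → ℝ}
    (hf : Measurable f) {M : ℝ} (hM : ∀ x, |f x| ≤ M) {c : ℝ} (hc : ∀ x y, |f x - f y| ≤ c) :
    ∫ x, Real.exp (f x) ∂ν ≤ Real.exp (∫ x, f x ∂ν + c ^ 2 / 2) := by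
  set m := ∫ x, f x ∂ν with hm
  have hfi : Integrable f ν := integrable_of_bound hf hM
  have hdev : ∀ x, |f x - m| ≤ c := by
    intro x
    have : f x - m = ∫ y, (f x - f y) ∂ν := by
      rw [integral_sub (integrable_const _) hfi]; simp [hm]
    rw [this]
    exact abs_integral_le_of_bound fun y => hc x y
  have hsub := hasSubgaussianMGF_of_mem_Icc (μ := ν) (a := m - c) (b := m + c) hf.aemeasurable
    (ae_of_all _ fun x => by
      have := abs_le.1 (hdev x)
      exact ⟨by linarith, by linarith⟩)
  have h1 := hsub.mgf_le 1
  have h2 : (m + c - (m - c)) = 2 * c := by ring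
  simp only [mgf, one_mul, h2, ← hm, Real.exp_sub, integral_div] at h1
  rw [div_le_iff₀ (Real.exp_pos _), ← Real.exp_add] at h1
  refine h1.trans (le_of_eq ?_)
  congr 1
  push_cast
  rw [norm_mul, Real.norm_ofNat, Real.norm_eq_abs, mul_div_cancel_left₀ _ two_ne_zero, sq_abs]
  ring

/-- Conditioning on the first coordinate: the remaining integral falls under the induction
hypothesis, and the conditional mean `F` inherits oscillation at most `c 0`, so the one-variable
bound finishes. -/
lemma integral_exp_le_of_bounded_differences_fin {n : ℕ} {Q : Fin n → Measure Z}
    [∀ i, IsProbabilityMeasure (Q i)] {f : (Fin n → Z) → ℝ} (hf : Measurable f) {M : ℝ}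
    (hM : ∀ z, |f z| ≤ M) {c : Fin n → ℝ}
    (hc : ∀ z i x, |f (Function.update z i x) - f z| ≤ c i) :
    ∫ z, Real.exp (f z) ∂(Measure.pi Q)
      ≤ Real.exp (∫ z, f z ∂(Measure.pi Q) + (∑ i, c i ^ 2) / 2) := by
  induction n with
  | zero =>
    have : ∀ z, f z = f default := fun z => congrArg f (Subsingleton.elim _ _)
    simp only [this]; simp
  | succ n ih =>
    have hmp := (measurePreserving_piFinSuccAbove Q 0).symm
    have hcons : ∀ p : Z × (Fin n → Z), (MeasurableEquiv.piFinSuccAbove (fun _ => Z) 0).symm p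
        = Fin.cons p.1 p.2 := by
      intro p; simp [MeasurableEquiv.piFinSuccAbove]; rfl
    have hm : Measurable fun p : Z × (Fin n → Z) => f (Fin.cons p.1 p.2) := by
      have := hf.comp (MeasurableEquiv.piFinSuccAbove (fun _ : Fin (n + 1) => Z) 0).symm.measurable
      simpa only [Function.comp_def, hcons] using this
    rw [← hmp.integral_comp', ← hmp.integral_comp']
    simp only [hcons, Fin.zero_succAbove]
    set ρ := Measure.pi fun i : Fin n => Q i.succ with hρ
    set F : Z → ℝ := fun x => ∫ y, f (Fin.cons x y) ∂ρ with hF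
    have hFm : Measurable F := by
      have := hm.stronglyMeasurable.integral_prod_right' (ν := ρ)
      exact this.measurable
    have hfi : ∀ x, Integrable (fun y => f (Fin.cons x y)) ρ := fun x =>
      integrable_of_bound (hm.comp measurable_prodMk_left) fun y => hM _
    have hexpb : ∀ p : Z × (Fin n → Z), |Real.exp (f (Fin.cons p.1 p.2))| ≤ Real.exp M := fun p => by
      rw [abs_of_pos (Real.exp_pos _)]
      exact Real.exp_le_exp.2 ((le_abs_self _).trans (hM _))
    have hFosc : ∀ x x', |F x - F x'| ≤ c 0 := by
      intro x x'
      rw [hF, ← integral_sub (hfi x) (hfi x')]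
      refine abs_integral_le_of_bound fun y => ?_
      have := hc (Fin.cons x' y) 0 x
      rwa [Fin.update_cons_zero] at this
    have inner : ∀ x, ∫ y, Real.exp (f (Fin.cons x y)) ∂ρ
        ≤ Real.exp (F x) * Real.exp ((∑ i : Fin n, c i.succ ^ 2) / 2) := by
      intro x
      rw [← Real.exp_add]
      refine ih (Q := fun i => Q i.succ) (hm.comp measurable_prodMk_left) (fun y => hM _) ?_
      intro y i x'
      have := hc (Fin.cons x y) i.succ x'
      rwa [← Fin.cons_update] at this
    have hFb : ∀ x, |F x| ≤ M := fun x => abs_integral_le_of_bound fun y => hM _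
    rw [integral_prod _ (integrable_of_bound hm.exp hexpb),
      integral_prod _ (integrable_of_bound hm fun p => hM _)]
    calc ∫ x, ∫ y, Real.exp (f (Fin.cons x y)) ∂ρ ∂(Q 0)
        ≤ ∫ x, Real.exp (F x) * Real.exp ((∑ i : Fin n, c i.succ ^ 2) / 2) ∂(Q 0) := by
          refine integral_mono ?_ ?_ inner
          · exact (integrable_of_bound (ν := (Q 0).prod ρ) hm.exp
              hexpb).integral_prod_left
          · refine Integrable.mul_const ?_ _
            refine integrable_of_bound (M := Real.exp M) hFm.exp fun x => ?_
            rw [abs_of_pos (Real.exp_pos _)]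
            exact Real.exp_le_exp.2 ((le_abs_self _).trans (hFb x))
      _ ≤ Real.exp (∫ x, F x ∂(Q 0) + c 0 ^ 2 / 2)
            * Real.exp ((∑ i : Fin n, c i.succ ^ 2) / 2) := by
          rw [integral_mul_const]
          exact mul_le_mul_of_nonneg_right (integral_exp_le_of_oscillation hFm hFb hFosc)
            (Real.exp_pos _).le
      _ = _ := by
          rw [← Real.exp_add, Fin.sum_univ_succ]
          congr 1; ring

lemma integral_exp_le_of_bounded_differences {ι : Type*} [Fintype ι] [DecidableEq ι]
    {Q : ι → Measure Z} [∀ i, IsProbabilityMeasure (Q i)] {f : (ι → Z) → ℝ} (hf : Measurable f)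
    {M : ℝ} (hM : ∀ z, |f z| ≤ M) {c : ι → ℝ}
    (hc : ∀ z i x, |f (Function.update z i x) - f z| ≤ c i) :
    ∫ z, Real.exp (f z) ∂(Measure.pi Q)
      ≤ Real.exp (∫ z, f z ∂(Measure.pi Q) + (∑ i, c i ^ 2) / 2) := by
  let e := (Fintype.equivFin ι).symm
  have hmp := measurePreserving_piCongrLeft (fun i => Q i) e
  have hcomp : ∀ z, MeasurableEquiv.piCongrLeft (fun _ => Z) e z = z ∘ e.symm := by
    intro z; ext i
    obtain ⟨k, rfl⟩ := e.surjective i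
    simp [MeasurableEquiv.coe_piCongrLeft, Equiv.piCongrLeft_apply_apply]
  rw [← hmp.integral_comp', ← hmp.integral_comp', ← Equiv.sum_comp e]
  simp only [hcomp]
  refine integral_exp_le_of_bounded_differences_fin (Q := fun i => Q (e i)) ?_ (fun z => hM _) ?_
  · exact hf.comp (by fun_prop)
  · intro z i x
    rw [Function.update_comp_equiv]
    exact hc _ _ _

/-- Bounded differences inequality (with the constant of the Azuma--Hoeffding argument). -/
theorem measureReal_ge_le_of_bounded_differences {ι : Type*} [Fintype ι] [DecidableEq ι]
    {Q : ι → Measure Z} [∀ i, IsProbabilityMeasure (Q i)] {f : (ι → Z) → ℝ} (hf : Measurable f)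
    {M : ℝ} (hM : ∀ z, |f z| ≤ M) {c : ι → ℝ}
    (hc : ∀ z i x, |f (Function.update z i x) - f z| ≤ c i) {V : ℝ} (hV : 0 < V)
    (hcV : ∑ i, c i ^ 2 ≤ V) {s : ℝ} (hs : 0 ≤ s) :
    (Measure.pi Q).real {z | ∫ z, f z ∂(Measure.pi Q) + s ≤ f z}
      ≤ Real.exp (-s ^ 2 / (2 * V)) := by
  set E := ∫ z, f z ∂(Measure.pi Q) with hE
  -- This `l` minimises the Chernoff exponent `-l s + l² V / 2`.
  set l := s / V with hl
  have hl0 : 0 ≤ l := by positivity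
  have hlM : ∀ z, |l * f z| ≤ l * M := fun z => by
    rw [abs_mul, abs_of_nonneg hl0]; exact mul_le_mul_of_nonneg_left (hM z) hl0
  have hint : Integrable (fun z => Real.exp (l * f z)) (Measure.pi Q) := by
    refine integrable_of_bound (M := Real.exp (l * M)) (by fun_prop) fun z => ?_
    rw [abs_of_pos (Real.exp_pos _)]
    exact Real.exp_le_exp.2 ((le_abs_self _).trans (hlM z))
  have hmgf := integral_exp_le_of_bounded_differences (Q := Q) (f := fun z => l * f z)
    (c := fun i => l * c i) (by fun_prop) hlM (fun z i x => by
      rw [← mul_sub, abs_mul, abs_of_nonneg hl0]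
      exact mul_le_mul_of_nonneg_left (hc z i x) hl0)
  refine (measure_ge_le_exp_mul_mgf (E + s) hl0 hint).trans ?_
  rw [mgf]
  refine (mul_le_mul_of_nonneg_left hmgf (Real.exp_pos _).le).trans ?_
  rw [← Real.exp_add, integral_const_mul, ← hE]
  refine Real.exp_le_exp.2 ?_
  have h1 : ∑ i, (l * c i) ^ 2 ≤ l ^ 2 * V := by
    simp only [mul_pow, ← Finset.mul_sum]
    exact mul_le_mul_of_nonneg_left hcV (sq_nonneg l)
  have h2 : l ^ 2 * V = s ^ 2 / V := by rw [hl]; field_simp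
  have h3 : l * s = s ^ 2 / V := by rw [hl]; ring
  have h4 : -s ^ 2 / (2 * V) = - (s ^ 2 / V) / 2 := by field_simp
  rw [h4]
  linarith [mul_add l E s]

end McDiarmid

/-! ### Suprema of bounded families and integration helpers -/

section Supremum

lemma bddAbove_range_of_abs_le {T : Type*} {g : T → ℝ} {M : ℝ} (h : ∀ t, |g t| ≤ M) :
    BddAbove (Set.range g) :=
  ⟨M, by rintro _ ⟨t, rfl⟩; exact (le_abs_self _).trans (h t)⟩

variable {T : Type*} [Nonempty T]

lemma abs_ciSup_le {g : T → ℝ} {M : ℝ} (h : ∀ t, |g t| ≤ M) : |⨆ t, g t| ≤ M := by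
  obtain ⟨t₀⟩ := ‹Nonempty T›
  refine abs_le.2 ⟨?_, ciSup_le fun t => (le_abs_self _).trans (h t)⟩
  exact (neg_le_of_abs_le (h t₀)).trans (le_ciSup (bddAbove_range_of_abs_le h) t₀)

lemma abs_ciSup_sub_ciSup_le {g h : T → ℝ} {c : ℝ} (hg : BddAbove (Set.range g))
    (hh : BddAbove (Set.range h)) (hc : ∀ t, |g t - h t| ≤ c) :
    |(⨆ t, g t) - ⨆ t, h t| ≤ c := by
  refine abs_sub_le_iff.2 ⟨?_, ?_⟩
  · have : (⨆ t, g t) ≤ c + ⨆ t, h t := ciSup_le fun t => by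
      have := le_ciSup hh t
      have := (abs_sub_le_iff.1 (hc t)).1
      linarith
    linarith
  · have : (⨆ t, h t) ≤ c + ⨆ t, g t := ciSup_le fun t => by
      have := le_ciSup hg t
      have := (abs_sub_le_iff.1 (hc t)).2
      linarith
    linarith

end Supremum

lemma integral_comp_measurePreserving {α β : Type*} [MeasurableSpace α] [MeasurableSpace β]
    {μ : Measure α} {ν : Measure β} {φ : α → β} (hφ : MeasurePreserving φ μ ν) {f : β → ℝ}
    (hf : Measurable f) : ∫ x, f (φ x) ∂μ = ∫ y, f y ∂ν := by
  rw [← hφ.map_eq, integral_map hφ.measurable.aemeasurable hf.aestronglyMeasurable]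

lemma abs_intUnit (σ : ℤˣ) : |((σ : ℤ) : ℝ)| = 1 := by
  rcases Int.units_eq_one_or σ with h | h <;> simp [h]

lemma abs_sum_le_card_mul {ι : Type*} [Fintype ι] {g : ι → ℝ} {M : ℝ} (h : ∀ i, |g i| ≤ M) :
    |∑ i, g i| ≤ Fintype.card ι * M :=
  (Finset.abs_sum_le_sum_abs _ _).trans
    (by simpa using Finset.sum_le_sum fun i (_ : i ∈ Finset.univ) => h i)

lemma integral_mean {α β : Type*} [Fintype α] [MeasurableSpace β] {μ : Measure β}
    {f : α → β → ℝ} (hf : ∀ a, Integrable (f a) μ) :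
    ∫ y, mean (fun a => f a y) ∂μ = mean fun a => ∫ y, f a y ∂μ := by
  simp only [mean]
  rw [integral_const_mul, integral_finsetSum _ fun a _ => hf a]

lemma integrable_mean {α β : Type*} [Fintype α] [MeasurableSpace β] {μ : Measure β}
    {f : α → β → ℝ} (hf : ∀ a, Integrable (f a) μ) :
    Integrable (fun y => mean (fun a => f a y)) μ :=
  (integrable_finsetSum _ fun a _ => hf a).const_mul _

/-! ### Symmetrization and the uniform deviation inequality -/

section Symmetrization

variable {Z T ι : Type*} [MeasurableSpace Z] [Countable T] [Nonempty T] [Fintype ι]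
  {Q : ι → Measure Z} [∀ i, IsProbabilityMeasure (Q i)] {F : ι → T → Z → ℝ} {M : ℝ}

/-- Symmetrization: the expected uniform one-sided deviation is at most twice the expected signed
supremum. -/
lemma integral_ciSup_deviation_le [DecidableEq ι] (hF : ∀ i t, Measurable (F i t))
    (hM : ∀ i t z, |F i t z| ≤ M) :
    ∫ z, ⨆ t, ∑ i, (∫ y, F i t y ∂(Q i) - F i t (z i)) ∂(Measure.pi Q) ≤
      2 * ∫ z, mean (fun σ : ι → ℤˣ => ⨆ t, ∑ i, ((σ i : ℤ) : ℝ) * F i t (z i))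
        ∂(Measure.pi Q) := by
  set π := Measure.pi Q with hπ
  set ρ : Measure (ι → Z × Z) := Measure.pi fun i => (Q i).prod (Q i) with hρ
  set G : (ι → ℤˣ) → (ι → Z) → ℝ := fun σ z => ⨆ t, ∑ i, ((σ i : ℤ) : ℝ) * F i t (z i) with hG
  set D : (ι → Z × Z) → ℝ := fun p => ⨆ t, ∑ i, (F i t (p i).1 - F i t (p i).2) with hD
  have hGm : ∀ σ, Measurable (G σ) := fun σ => Measurable.iSup fun t =>
    Finset.measurable_sum _ fun i _ => ((hF i t).comp (measurable_pi_apply i)).const_mul _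
  have hDm : Measurable D := Measurable.iSup fun t => Finset.measurable_sum _ fun i _ =>
    ((hF i t).comp (measurable_fst.comp (measurable_pi_apply i))).sub
      ((hF i t).comp (measurable_snd.comp (measurable_pi_apply i)))
  have hGt : ∀ (σ : ι → ℤˣ) (z : ι → Z) t, |∑ i, ((σ i : ℤ) : ℝ) * F i t (z i)| ≤ Fintype.card ι * M :=
    fun σ z t => abs_sum_le_card_mul fun i => by rw [abs_mul, abs_intUnit, one_mul]; exact hM _ _ _
  have hDt : ∀ (p : ι → Z × Z) t,
      |∑ i, (F i t (p i).1 - F i t (p i).2)| ≤ Fintype.card ι * (M + M) :=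
    fun p t => abs_sum_le_card_mul fun i =>
      (abs_sub _ _).trans (add_le_add (hM _ _ _) (hM _ _ _))
  have hGi : ∀ σ, Integrable (G σ) π := fun σ =>
    integrable_of_bound (hGm σ) fun z => abs_ciSup_le (hGt σ z)
  have hDi : Integrable D ρ := integrable_of_bound hDm fun p => abs_ciSup_le (hDt p)
  have hm : ∀ i t, |∫ y, F i t y ∂(Q i)| ≤ M := fun i t => abs_integral_le_of_bound (hM i t)
  have hfst : MeasurePreserving (fun (p : ι → Z × Z) i => (p i).1) ρ π :=
    measurePreserving_pi _ _ fun i => measurePreserving_fst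
  have hsnd : MeasurePreserving (fun (p : ι → Z × Z) i => (p i).2) ρ π :=
    measurePreserving_pi _ _ fun i => measurePreserving_snd
  have hprod := measurePreserving_arrowProdEquivProdArrow Z Z ι Q Q
  have hpair : ∀ q : (ι → Z) × (ι → Z),
      (MeasurableEquiv.arrowProdEquivProdArrow Z Z ι).symm q = fun i => (q.1 i, q.2 i) :=
    fun q => rfl
  have hDi' : Integrable (fun q : (ι → Z) × (ι → Z) => D fun i => (q.1 i, q.2 i)) (π.prod π) :=
    integrable_of_bound (hDm.comp (MeasurableEquiv.arrowProdEquivProdArrow Z Z ι).symm.measurable)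
      fun q => abs_ciSup_le (hDt _)
  -- Each mean is replaced by the expectation over an independent ghost sample (first components),
  -- and the supremum is then moved inside that expectation.
  have ghost : ∫ z, ⨆ t, ∑ i, (∫ y, F i t y ∂(Q i) - F i t (z i)) ∂π ≤ ∫ p, D p ∂ρ := by
    rw [← hprod.symm.integral_comp']
    simp only [hpair]
    rw [integral_prod_symm _ hDi']
    refine integral_mono ?_ hDi'.integral_prod_right fun z => ciSup_le fun t => ?_
    · refine integrable_of_bound (M := Fintype.card ι * (M + M)) ?_ fun z =>
        abs_ciSup_le fun t => abs_sum_le_card_mul fun i =>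
          (abs_sub _ _).trans (add_le_add (hm i t) (hM _ _ _))
      exact Measurable.iSup fun t => Finset.measurable_sum _ fun i _ =>
        measurable_const.sub ((hF i t).comp (measurable_pi_apply i))
    · have e1 : ∀ i, Integrable (fun y : ι → Z => F i t (y i)) π := fun i =>
        integrable_of_bound ((hF i t).comp (measurable_pi_apply i)) fun y => hM _ _ _
      have e1' : ∀ i, Integrable (fun y : ι → Z => F i t (y i) - F i t (z i)) π := fun i =>
        (e1 i).sub (integrable_const _)
      have e2 : ∑ i, (∫ y, F i t y ∂(Q i) - F i t (z i))
          = ∫ y : ι → Z, ∑ i, (F i t (y i) - F i t (z i)) ∂π := by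
        rw [integral_finsetSum _ fun i _ => e1' i]
        refine Finset.sum_congr rfl fun i _ => ?_
        rw [integral_sub (e1 i) (integrable_const _),
          integral_comp_measurePreserving (measurePreserving_eval Q i) (hF i t)]
        simp
      rw [e2]
      refine integral_mono (integrable_finsetSum _ fun i _ => e1' i) ?_
        fun y => le_ciSup (bddAbove_range_of_abs_le (hDt fun i => (y i, z i))) t
      refine integrable_of_bound (hDm.comp ?_) fun y => abs_ciSup_le (hDt _)
      exact measurable_pi_lambda _ fun i => (measurable_pi_apply i).prodMk measurable_const
  -- Exchanging the two components of a pair where `σ i = -1` preserves `ρ`, because both have law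
  -- `Q i`; the laws may differ between indices. It multiplies the `i`-th difference by `σ i`.
  have swap : ∀ σ, ∫ p, D p ∂ρ ≤ ∫ z, G σ z ∂π + ∫ z, G (-σ) z ∂π := by
    intro σ
    have hmp : MeasurePreserving
        (fun (p : ι → Z × Z) i => if σ i = 1 then p i else (p i).swap) ρ ρ := by
      refine measurePreserving_pi (fun i => (Q i).prod (Q i)) (fun i => (Q i).prod (Q i))
        (f := fun i x => if σ i = 1 then x else x.swap) fun i => ?_
      by_cases h : σ i = 1
      · simp only [h, if_true]; exact MeasurePreserving.id _
      · simpa [h] using Measure.measurePreserving_swap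
    have i1 : Integrable (fun p : ι → Z × Z => G σ fun i => (p i).1) ρ :=
      hfst.integrable_comp_of_integrable (hGi σ)
    have i2 : Integrable (fun p : ι → Z × Z => G (-σ) fun i => (p i).2) ρ :=
      hsnd.integrable_comp_of_integrable (hGi (-σ))
    rw [← integral_comp_measurePreserving hmp hDm,
      ← integral_comp_measurePreserving hfst (hGm σ),
      ← integral_comp_measurePreserving hsnd (hGm (-σ)), ← integral_add i1 i2]
    refine integral_mono (hmp.integrable_comp_of_integrable hDi) (i1.add i2)
      fun p => ciSup_le fun t => ?_
    have b1 := le_ciSup (bddAbove_range_of_abs_le (hGt σ fun i => (p i).1)) t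
    have b2 := le_ciSup (bddAbove_range_of_abs_le (hGt (-σ) fun i => (p i).2)) t
    refine le_trans (le_of_eq ?_) (add_le_add b1 b2)
    rw [← Finset.sum_add_distrib]
    refine Finset.sum_congr rfl fun i _ => ?_
    rcases Int.units_eq_one_or (σ i) with h | h <;> simp [h] <;> ring
  refine ghost.trans ?_
  rw [integral_mean hGi, ← mean_const (α := ι → ℤˣ) (∫ p, D p ∂ρ)]
  refine (mean_mono swap).trans (le_of_eq ?_)
  have hneg : (mean fun σ => ∫ z, G (-σ) z ∂π) = mean fun σ => ∫ z, G σ z ∂π :=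
    mean_equiv (Equiv.neg (ι → ℤˣ)) fun σ => ∫ z, G σ z ∂π
  rw [mean_add, hneg]
  ring

variable {d : ℕ} {V : T → Z → Vec d} {L B b : ℝ}

/-- High-probability bound for the uniform deviation, relative to a fixed member `t₀` of the
class, in terms of the Rademacher complexity of the vector-valued functions `V`. -/
theorem measureReal_deviation_le [DecidableEq ι] [Nonempty ι] (hF : ∀ i t, Measurable (F i t))
    (hF0 : ∀ i t z, 0 ≤ F i t z) (hFb : ∀ i t z, F i t z ≤ b) (hV : ∀ t, Measurable (V t))
    (hVB : ∀ t z, ‖V t z‖ ≤ B) (hL : 0 ≤ L)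
    (hlip : ∀ i t s z, |F i t z - F i s z| ≤ L * ‖V t z - V s z‖) (t₀ : T)
    {δ : ℝ} (hδ : 0 < δ) (hδ1 : δ < 1) :
    (Measure.pi Q).real {z | 4 * √2 * L * (∫ z, mean (fun ε : ι → Fin d → ℤˣ =>
          ⨆ t, ∑ i, ∑ k, ((ε i k : ℤ) : ℝ) * V t (z i) k) ∂(Measure.pi Q))
        + 2 * b * √(2 * Real.log (1 / δ) * Fintype.card ι)
        < ⨆ t, (∑ i, (∫ y, F i t y ∂(Q i) - F i t (z i))
          - ∑ i, (∫ y, F i t₀ y ∂(Q i) - F i t₀ (z i)))} ≤ δ := by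
  set π := Measure.pi Q with hπ
  set m : ι → T → ℝ := fun i t => ∫ y, F i t y ∂(Q i) with hm_def
  set Rad := ∫ z, mean (fun ε : ι → Fin d → ℤˣ =>
    ⨆ t, ∑ i, ∑ k, ((ε i k : ℤ) : ℝ) * V t (z i) k) ∂π with hRad
  set f : (ι → Z) → ℝ := fun z => ⨆ t, (∑ i, (m i t - F i t (z i))
    - ∑ i, (m i t₀ - F i t₀ (z i))) with hf
  have hFabs : ∀ i t z, |F i t z| ≤ b := fun i t z => by
    rw [abs_of_nonneg (hF0 i t z)]; exact hFb i t z
  have hm : ∀ i t, |m i t| ≤ b := fun i t => abs_integral_le_of_bound (hFabs i t)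
  have hdev : ∀ t (z : ι → Z), |∑ i, (m i t - F i t (z i))| ≤ Fintype.card ι * (b + b) :=
    fun t z => abs_sum_le_card_mul fun i =>
      (abs_sub _ _).trans (add_le_add (hm i t) (hFabs _ _ _))
  have hdevm : ∀ t, Measurable fun z : ι → Z => ∑ i, (m i t - F i t (z i)) := fun t =>
    Finset.measurable_sum _ fun i _ =>
      measurable_const.sub ((hF i t).comp (measurable_pi_apply i))
  have hdiff : ∀ (z : ι → Z) t, |∑ i, (m i t - F i t (z i)) - ∑ i, (m i t₀ - F i t₀ (z i))|
      ≤ Fintype.card ι * (b + b) + Fintype.card ι * (b + b) := fun z t =>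
    (abs_sub _ _).trans (add_le_add (hdev t z) (hdev t₀ z))
  have hfm : Measurable f := Measurable.iSup fun t => (hdevm t).sub (hdevm t₀)
  have hfb : ∀ z, |f z| ≤ _ := fun z => abs_ciSup_le (hdiff z)
  -- The reference deviation at `t₀` integrates to zero, leaving symmetrization (2) times
  -- contraction (`2√2 L`).
  have hmean : ∫ z, f z ∂π ≤ 4 * √2 * L * Rad := by
    have e1 : ∀ z, f z = (⨆ t, ∑ i, (m i t - F i t (z i))) - ∑ i, (m i t₀ - F i t₀ (z i)) := by
      intro z
      rw [hf]
      exact (ciSup_sub (bddAbove_range_of_abs_le fun t => hdev t z) _).symm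
    have e2 : ∫ z : ι → Z, ∑ i, (m i t₀ - F i t₀ (z i)) ∂π = 0 := by
      have e3 : ∀ i, Integrable (fun y : ι → Z => F i t₀ (y i)) π := fun i =>
        integrable_of_bound ((hF i t₀).comp (measurable_pi_apply i)) fun y => hFabs _ _ _
      have e3' : ∀ i, Integrable (fun z : ι → Z => m i t₀ - F i t₀ (z i)) π := fun i =>
        (integrable_const _).sub (e3 i)
      rw [integral_finsetSum _ fun i _ => e3' i]
      refine Finset.sum_eq_zero fun i _ => ?_
      rw [integral_sub (integrable_const _) (e3 i),
        integral_comp_measurePreserving (measurePreserving_eval Q i) (hF i t₀)]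
      simp [hm_def]
    have e4 : Integrable (fun z : ι → Z => ⨆ t, ∑ i, (m i t - F i t (z i))) π :=
      integrable_of_bound (Measurable.iSup hdevm) fun z => abs_ciSup_le fun t => hdev t z
    simp only [e1]
    rw [integral_sub e4 (integrable_of_bound (hdevm t₀) (hdev t₀)), e2, sub_zero]
    refine (integral_ciSup_deviation_le hF hFabs).trans ?_
    have hsum : ∀ (ε : ι → Fin d → ℤˣ) (z : ι → Z) t,
        |∑ i, ∑ k, ((ε i k : ℤ) : ℝ) * V t (z i) k| ≤ Fintype.card ι * (d * B) := fun ε z t =>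
      abs_sum_le_card_mul fun i => (abs_sign_linear_le _ _).trans
        (mul_le_mul_of_nonneg_left (hVB _ _) (by positivity))
    have e5 : ∫ z, mean (fun σ : ι → ℤˣ => ⨆ t, ∑ i, ((σ i : ℤ) : ℝ) * F i t (z i)) ∂π
        ≤ ∫ z, 2 * √2 * L * mean (fun ε : ι → Fin d → ℤˣ =>
          ⨆ t, ∑ i, ∑ k, ((ε i k : ℤ) : ℝ) * V t (z i) k) ∂π := by
      refine integral_mono (integrable_mean fun σ => ?_)
        ((integrable_mean fun ε => ?_).const_mul _) fun z => ?_
      · refine integrable_of_bound (M := Fintype.card ι * b) ?_ fun z =>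
          abs_ciSup_le fun t => abs_sum_le_card_mul fun i => ?_
        · exact Measurable.iSup fun t => Finset.measurable_sum _ fun i _ =>
            ((hF i t).comp (measurable_pi_apply i)).const_mul _
        · rw [abs_mul, abs_intUnit, one_mul]; exact hFabs _ _ _
      · refine integrable_of_bound ?_ fun z => abs_ciSup_le (hsum ε z)
        refine Measurable.iSup fun t => Finset.measurable_sum _ fun i _ =>
          Finset.measurable_sum _ fun k _ => Measurable.const_mul ?_ _
        have := (hV t).comp (measurable_pi_apply (X := fun _ : ι => Z) i)
        fun_prop
      · exact mean_ciSup_sum_sign_le (h := fun i t => F i t (z i)) (v := fun i t => V t (z i)) hL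
          (fun i t => hFabs _ _ _) (fun i t => hVB _ _) (fun i t s => hlip _ _ _ _)
    rw [integral_const_mul] at e5
    linarith
  have hlog : 0 < Real.log (1 / δ) := Real.log_pos (one_lt_one_div hδ hδ1)
  have hb0 : 0 ≤ b := by
    obtain ⟨i⟩ := ‹Nonempty ι›
    obtain ⟨z⟩ := (Q i).nonempty_of_neZero
    exact (hF0 i t₀ z).trans (hFb i t₀ z)
  -- For `b = 0` the variance proxy below would vanish; in that case all losses are zero and the
  -- event is empty.
  rcases hb0.eq_or_lt with hb | hb
  · have hF00 : ∀ i t z, F i t z = 0 := fun i t z => le_antisymm (hb ▸ hFb i t z) (hF0 i t z)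
    have hf0 : ∀ z, f z = 0 := fun z => by simp [hf, hm_def, hF00]
    have : {z | 4 * √2 * L * Rad + 2 * b * √(2 * Real.log (1 / δ) * Fintype.card ι) < f z} = ∅ := by
      ext z
      simp only [hf0, integral_zero] at hmean
      simp only [← hb, hf0, Set.mem_ofPred_eq, Set.mem_empty_iff_false, iff_false, not_lt]
      linarith
    rw [this]; simpa using hδ.le
  -- Changing one sample moves the deviation at `t` and the one at `t₀` by at most `b` each.
  have hbd : ∀ (z : ι → Z) (i : ι) x, |f (Function.update z i x) - f z| ≤ 2 * b := by
    intro z i x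
    refine abs_ciSup_sub_ciSup_le (bddAbove_range_of_abs_le (hdiff _))
      (bddAbove_range_of_abs_le (hdiff _)) fun t => ?_
    have e : ∀ s, ∑ k, (m k s - F k s (Function.update z i x k)) - ∑ k, (m k s - F k s (z k))
        = F i s (z i) - F i s x := by
      intro s
      rw [← Finset.sum_sub_distrib, Finset.sum_eq_single i]
      · simp
      · intro k _ hk; simp [hk]
      · simp
    have e1 := e t
    have e2 := e t₀
    have := hF0 i t x; have := hF0 i t (z i); have := hF0 i t₀ x; have := hF0 i t₀ (z i)
    have := hFb i t x; have := hFb i t (z i); have := hFb i t₀ x; have := hFb i t₀ (z i)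
    rw [abs_le]
    constructor <;> linarith
  have hn : (0 : ℝ) < Fintype.card ι := by exact_mod_cast Fintype.card_pos
  have hMc := measureReal_ge_le_of_bounded_differences (Q := Q) hfm hfb hbd
    (V := Fintype.card ι * (2 * b) ^ 2) (by positivity) (by simp)
    (s := 2 * b * √(2 * Real.log (1 / δ) * Fintype.card ι)) (by positivity)
  have hval : -(2 * b * √(2 * Real.log (1 / δ) * Fintype.card ι)) ^ 2
      / (2 * (Fintype.card ι * (2 * b) ^ 2)) = Real.log δ := by
    rw [mul_pow, Real.sq_sqrt (by positivity), Real.log_div one_ne_zero hδ.ne', Real.log_one]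
    field_simp
    ring
  rw [hval, Real.exp_log hδ] at hMc
  refine (measureReal_mono fun z hz => ?_).trans hMc
  have hz' : 4 * √2 * L * Rad + 2 * b * √(2 * Real.log (1 / δ) * Fintype.card ι) < f z := hz
  exact (by linarith : ∫ z, f z ∂π + 2 * b * √(2 * Real.log (1 / δ) * Fintype.card ι) ≤ f z)

end Symmetrization

/-! ### Lipschitz continuity, boundedness and measurability of the SPO+ loss -/

section Loss

variable {d : ℕ} {S : Set (Vec d)} {w : Vec d → Vec d}

lemma inner_le_supportFun (hS : IsCompact S) (u : Vec d) {v : Vec d} (hv : v ∈ S) :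
    inner ℝ u v ≤ supportFun S u :=
  le_csSup (hS.image (by fun_prop)).bddAbove ⟨v, hv, rfl⟩

lemma exists_supportFun_eq (hS : IsCompact S) (hne : S.Nonempty) (u : Vec d) :
    ∃ v ∈ S, supportFun S u = inner ℝ u v :=
  hS.exists_sSup_image_eq hne (by fun_prop)

lemma optValue_eq (hw : IsOracle S w) (c : Vec d) : optValue S c = inner ℝ c (w c) :=
  IsLeast.csInf_eq ⟨⟨w c, (hw c).1, rfl⟩, by rintro _ ⟨v, hv, rfl⟩; exact (hw c).2 v hv⟩

lemma spoPlus_eq (hw : IsOracle S w) (a c : Vec d) :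
    spoPlus S w a c
      = supportFun S (c - (2 : ℝ) • a) + 2 * inner ℝ a (w c) - inner ℝ c (w c) := by
  rw [spoPlus, optValue_eq hw]

lemma spoPlus_nonneg (hS : IsCompact S) (hw : IsOracle S w) (a c : Vec d) :
    0 ≤ spoPlus S w a c := by
  have := inner_le_supportFun hS (c - (2 : ℝ) • a) (hw c).1
  rw [inner_sub_left, real_inner_smul_left] at this
  rw [spoPlus_eq hw]; linarith

/-- The SPO+ loss is Lipschitz in the prediction, with constant twice the diameter of `S`. -/
lemma abs_spoPlus_sub_le (hS : IsCompact S) (hne : S.Nonempty) (hw : IsOracle S w)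
    (a a' c : Vec d) :
    |spoPlus S w a c - spoPlus S w a' c| ≤ 2 * Metric.diam S * ‖a - a'‖ := by
  have key : ∀ a a' : Vec d,
      spoPlus S w a c - spoPlus S w a' c ≤ 2 * Metric.diam S * ‖a - a'‖ := by
    intro a a'
    -- With `v` a maximiser for `a`, the difference of losses is at most `2⟨a - a', w c - v⟩`. Both
    -- `w c` and `v` lie in `S`, whence the diameter.
    obtain ⟨v, hv, h⟩ := exists_supportFun_eq hS hne (c - (2 : ℝ) • a)
    have h' := inner_le_supportFun hS (c - (2 : ℝ) • a') hv
    have e : inner ℝ (a - a') (w c - v) ≤ ‖a - a'‖ * Metric.diam S :=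
      (real_inner_le_norm _ _).trans (mul_le_mul_of_nonneg_left
        (by rw [← dist_eq_norm]; exact Metric.dist_le_diam_of_mem hS.isBounded (hw c).1 hv)
        (norm_nonneg _))
    rw [spoPlus_eq hw, spoPlus_eq hw, h]
    simp only [inner_sub_left, inner_sub_right, real_inner_smul_left] at h' e ⊢
    linarith
  exact abs_sub_le_iff.2 ⟨key a a', by rw [norm_sub_rev]; exact key a' a⟩

lemma continuous_supportFun (hS : IsCompact S) (hne : S.Nonempty) :
    Continuous (supportFun S) := by
  obtain ⟨K, hK⟩ := hS.isBounded.exists_norm_le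
  have key : ∀ u u' : Vec d, supportFun S u ≤ supportFun S u' + K * dist u u' := by
    intro u u'
    obtain ⟨v, hv, h⟩ := exists_supportFun_eq hS hne u
    have h' := inner_le_supportFun hS u' hv
    have e : inner ℝ (u - u') v ≤ ‖u - u'‖ * K :=
      (real_inner_le_norm _ _).trans (mul_le_mul_of_nonneg_left (hK v hv) (norm_nonneg _))
    rw [inner_sub_left] at e
    rw [h, dist_eq_norm]; linarith
  obtain ⟨v, hv⟩ := hne
  exact (LipschitzWith.of_le_add_mul' K key).continuous

lemma measurable_spoPlus (hS : IsCompact S) (hne : S.Nonempty) (hw : IsOracle S w)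
    (hwm : Measurable w) {α : Type*} [MeasurableSpace α] {f g : α → Vec d} (hf : Measurable f)
    (hg : Measurable g) : Measurable fun x => spoPlus S w (f x) (g x) := by
  simp only [spoPlus_eq hw]
  have := (continuous_supportFun hS hne).measurable.comp (hg.sub (hf.const_smul (2 : ℝ)))
  exact (this.add ((hf.inner (hwm.comp hg)).const_mul 2)).sub (hg.inner (hwm.comp hg))

/-- Lipschitz continuity reduces the bound to the prediction `0`. It ensures that the `sSup` in
`lossBound` is a genuine supremum and not a default value. -/
lemma exists_spoPlus_le (hS : IsCompact S) (hne : S.Nonempty) (hw : IsOracle S w) (B Cmax : ℝ) :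
    ∃ K, ∀ a c : Vec d, ‖a‖ ≤ B → ‖c‖ ≤ Cmax → spoPlus S w a c ≤ K := by
  obtain ⟨K, hK⟩ := hS.isBounded.exists_norm_le
  refine ⟨2 * Metric.diam S * B + Cmax * K + Cmax * K, fun a c ha hc => ?_⟩
  have h0 := (le_abs_self _).trans (abs_spoPlus_sub_le hS hne hw a 0 c)
  rw [sub_zero] at h0
  have h1 : 2 * Metric.diam S * ‖a‖ ≤ 2 * Metric.diam S * B :=
    mul_le_mul_of_nonneg_left ha (by positivity)
  have hc' : ∀ v ∈ S, |inner ℝ c v| ≤ Cmax * K := fun v hv =>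
    (abs_real_inner_le_norm _ _).trans
      (mul_le_mul hc (hK v hv) (norm_nonneg _) ((norm_nonneg _).trans hc))
  have h2 : spoPlus S w 0 c ≤ Cmax * K + Cmax * K := by
    obtain ⟨v, hv, h⟩ := exists_supportFun_eq hS hne c
    rw [spoPlus_eq hw, smul_zero, sub_zero, h, inner_zero_left]
    have := abs_le.1 (hc' v hv); have := abs_le.1 (hc' _ (hw c).1)
    linarith
  linarith

lemma spoPlus_le_lossBound {X : Type*} (hS : IsCompact S) (hne : S.Nonempty) (hw : IsOracle S w)
    {H : Set (X → Vec d)} {C : Set (Vec d)} {B Cmax : ℝ} (hB : ∀ g ∈ H, ∀ x, ‖g x‖ ≤ B)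
    (hC : ∀ c ∈ C, ‖c‖ ≤ Cmax) {g : X → Vec d} (hg : g ∈ H) (x : X) {c : Vec d} (hc : c ∈ C) :
    spoPlus S w (g x) c ≤ lossBound S w H C := by
  obtain ⟨K, hK⟩ := exists_spoPlus_le hS hne hw B Cmax
  refine le_csSup ⟨K, ?_⟩ ⟨g, hg, x, c, hc, rfl⟩
  rintro _ ⟨g', hg', x', c', hc', rfl⟩
  exact hK _ _ (hB g' hg' x') (hC c' hc')

lemma tendsto_spoPlus (hS : IsCompact S) (hne : S.Nonempty) (hw : IsOracle S w)
    {u : ℕ → Vec d} {a c : Vec d} (hu : Tendsto u atTop (𝓝 a)) :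
    Tendsto (fun r => spoPlus S w (u r) c) atTop (𝓝 (spoPlus S w a c)) := by
  rw [tendsto_iff_norm_sub_tendsto_zero] at hu ⊢
  refine squeeze_zero (fun _ => norm_nonneg _) (fun r => abs_spoPlus_sub_le hS hne hw _ _ _) ?_
  simpa using hu.const_mul (2 * Metric.diam S)

end Loss

/-! ### Reduction to a countable pointwise dense subclass -/

section Class

variable {d : ℕ} {X : Type*} [MeasurableSpace X] {H T : Set (X → Vec d)} {B : ℝ}

/-- Adjoining `g₀` makes the reference predictor itself an index of the countable supremum. -/
lemma PointwiseMeasurable.exists_countable_dense (hH : PointwiseMeasurable H)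
    {g₀ : X → Vec d} (hg₀ : g₀ ∈ H) :
    ∃ T ⊆ H, T.Countable ∧ g₀ ∈ T ∧ ∀ g ∈ H, ∃ u : ℕ → X → Vec d,
      (∀ r, u r ∈ T) ∧ ∀ x, Tendsto (fun r => u r x) atTop (𝓝 (g x)) := by
  obtain ⟨-, H₀, hsub, hc, hlim⟩ := hH
  refine ⟨insert g₀ H₀, Set.insert_subset hg₀ hsub, hc.insert _, Set.mem_insert _ _, ?_⟩
  intro g hg
  obtain ⟨u, hu, hux⟩ := hlim g hg
  exact ⟨u, fun r => Set.mem_insert_of_mem _ (hu r), hux⟩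

/-- The Rademacher complexity of `H` may be computed on a pointwise dense subclass. -/
lemma rademacher_fst_eq {ι : Type} [Fintype ι] [DecidableEq ι]
    {Q : ι → Measure (X × Vec d)} [∀ i, IsProbabilityMeasure (Q i)]
    (hTm : ∀ g ∈ T, Measurable g) (hTH : T ⊆ H) (hTc : T.Countable) (hTne : T.Nonempty)
    (hlim : ∀ g ∈ H, ∃ u : ℕ → X → Vec d,
      (∀ r, u r ∈ T) ∧ ∀ x, Tendsto (fun r => u r x) atTop (𝓝 (g x)))
    (hB : ∀ g ∈ H, ∀ x, ‖g x‖ ≤ B) :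
    rademacher (fun i => (Q i).fst) H = (1 / (Fintype.card ι : ℝ)) *
      ∫ z, mean (fun ε : ι → Fin d → ℤˣ =>
        ⨆ t : T, ∑ i, ∑ k, ((ε i k : ℤ) : ℝ) * (t : X → Vec d) (z i).1 k) ∂(Measure.pi Q) := by
  have : Countable T := hTc.to_subtype
  have : Nonempty T := hTne.to_subtype
  have : Nonempty H := (hTne.mono hTH).to_subtype
  set ψ : (ι → X) → ℝ := fun x => mean fun ε : ι → Fin d → ℤˣ =>
    ⨆ t : T, ∑ i, ∑ k, ((ε i k : ℤ) : ℝ) * (t : X → Vec d) (x i) k with hψ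
  have hψm : Measurable ψ := by
    refine Measurable.const_mul (Finset.measurable_sum _ fun ε _ => Measurable.iSup fun t =>
      Finset.measurable_sum _ fun i _ => Finset.measurable_sum _ fun k _ =>
        Measurable.const_mul ?_ _) _
    exact (EuclideanSpace.proj (𝕜 := ℝ) k).continuous.measurable.comp
      ((hTm t t.2).comp (measurable_pi_apply i))
  have hsum : ∀ (ε : ι → Fin d → ℤˣ) (x : ι → X), ∀ g ∈ H,
      |∑ i, ∑ k, ((ε i k : ℤ) : ℝ) * g (x i) k| ≤ Fintype.card ι * (d * B) := fun ε x g hg =>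
    abs_sum_le_card_mul fun i => (abs_sign_linear_le _ _).trans
      (mul_le_mul_of_nonneg_left (hB g hg _) (by positivity))
  have hsup : ∀ (ε : ι → Fin d → ℤˣ) (x : ι → X),
      (⨆ g : H, (1 / (Fintype.card ι : ℝ)) *
          ∑ i, ∑ k, ((ε i k : ℤ) : ℝ) * (g : X → Vec d) (x i) k)
        = (1 / (Fintype.card ι : ℝ)) *
          ⨆ t : T, ∑ i, ∑ k, ((ε i k : ℤ) : ℝ) * (t : X → Vec d) (x i) k := by
    intro ε x
    rw [← Real.mul_iSup_of_nonneg (by positivity)]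
    congr 1
    have bT := bddAbove_range_of_abs_le fun t : T => hsum ε x t (hTH t.2)
    have bH := bddAbove_range_of_abs_le fun g : H => hsum ε x g g.2
    refine le_antisymm (ciSup_le fun g => ?_) (ciSup_le fun t => le_ciSup bH ⟨t, hTH t.2⟩)
    obtain ⟨u, hu, hux⟩ := hlim g g.2
    have ht : Tendsto (fun r => ∑ i, ∑ k, ((ε i k : ℤ) : ℝ) * u r (x i) k) atTop
        (𝓝 (∑ i, ∑ k, ((ε i k : ℤ) : ℝ) * (g : X → Vec d) (x i) k)) :=
      tendsto_finsetSum _ fun i _ => tendsto_finsetSum _ fun k _ => Tendsto.const_mul _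
        (((EuclideanSpace.proj (𝕜 := ℝ) k).continuous.tendsto _).comp (hux (x i)))
    exact le_of_tendsto' ht fun r => le_ciSup bT ⟨u r, hu r⟩
  have hpush : ∫ x, ψ x ∂(Measure.pi fun i => (Q i).fst)
      = ∫ z : ι → X × Vec d, ψ (fun i => (z i).1) ∂(Measure.pi Q) :=
    (integral_comp_measurePreserving
      (measurePreserving_pi Q (fun i => (Q i).fst) fun i => ⟨measurable_fst, rfl⟩) hψm).symm
  rw [rademacher]
  simp only [hsup]
  rw [← hpush, ← integral_const_mul]
  refine integral_congr_ae (ae_of_all _ fun x => ?_)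
  exact mean_const_mul _ _

end Class

/-! ### Uniform deviation of the SPO+ risk and the client–mixture discrepancy -/

section Deviation

variable {d : ℕ} {X : Type*} [MeasurableSpace X] {H : Set (X → Vec d)} {B D b : ℝ}
  {C : Set (Vec d)}

lemma tendsto_risk {S : Set (Vec d)} {w : Vec d → Vec d} (hS : IsCompact S) (hne : S.Nonempty)
    (hw : IsOracle S w) (hwm : Measurable w) {P : Measure (X × Vec d)} [IsProbabilityMeasure P]
    (hPC : ∀ᵐ z ∂P, z.2 ∈ C) {u : ℕ → X → Vec d} {g : X → Vec d} (hu : ∀ r, Measurable (u r))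
    (hub : ∀ r x, ∀ c ∈ C, spoPlus S w (u r x) c ≤ b)
    (hlim : ∀ x, Tendsto (fun r => u r x) atTop (𝓝 (g x))) :
    Tendsto (fun r => risk S w P (u r)) atTop (𝓝 (risk S w P g)) := by
  refine tendsto_integral_of_dominated_convergence (fun _ => b) (fun r => ?_)
    (integrable_const _) (fun r => ?_) (ae_of_all _ fun z => tendsto_spoPlus hS hne hw (hlim z.1))
  · exact (measurable_spoPlus hS hne hw hwm ((hu r).comp measurable_fst)
      measurable_snd).aestronglyMeasurable
  · filter_upwards [hPC] with z hz
    rw [Real.norm_of_nonneg (spoPlus_nonneg hS hw _ _)]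
    exact hub r z.1 z.2 hz

/-- Uniform deviation bound over `H`, relative to a fixed member, for independent samples from
possibly different clients. -/
theorem exists_uniform_deviation_event {ι : Type} [Fintype ι] [DecidableEq ι] [Nonempty ι]
    {S : ι → Set (Vec d)} {w : ι → Vec d → Vec d} {Q : ι → Measure (X × Vec d)}
    [∀ i, IsProbabilityMeasure (Q i)] (hS : ∀ i, IsCompact (S i)) (hne : ∀ i, (S i).Nonempty)
    (hw : ∀ i, IsOracle (S i) (w i)) (hwm : ∀ i, Measurable (w i))
    (hQC : ∀ i, ∀ᵐ z ∂(Q i), z.2 ∈ C) (hH : PointwiseMeasurable H)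
    (hB : ∀ g ∈ H, ∀ x, ‖g x‖ ≤ B) (hD : ∀ i, Metric.diam (S i) ≤ D)
    (hb : ∀ i, ∀ g ∈ H, ∀ x, ∀ c ∈ C, spoPlus (S i) (w i) (g x) c ≤ b)
    {g₀ : X → Vec d} (hg₀ : g₀ ∈ H) {δ : ℝ} (hδ : 0 < δ) (hδ1 : δ < 1) :
    ∃ E : Set (ι → X × Vec d), MeasurableSet E ∧ (Measure.pi Q).real Eᶜ ≤ δ ∧
      ∀ z ∈ E, (∀ i, (z i).2 ∈ C) → ∀ g ∈ H,
        ∑ i, (risk (S i) (w i) (Q i) g - spoPlus (S i) (w i) (g (z i).1) (z i).2)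
          - ∑ i, (risk (S i) (w i) (Q i) g₀ - spoPlus (S i) (w i) (g₀ (z i).1) (z i).2)
        ≤ Fintype.card ι * (2 * (4 * √2 * D * rademacher (fun i => (Q i).fst) H
          + b * √(2 * Real.log (1 / δ) / Fintype.card ι))) := by
  obtain ⟨T, hTH, hTc, hgT, hlim⟩ := hH.exists_countable_dense hg₀
  have hTm : ∀ g ∈ T, Measurable g := fun g hg => hH.1 g (hTH hg)
  have : Countable T := hTc.to_subtype
  have : Nonempty T := ⟨⟨g₀, hgT⟩⟩
  have hb0 : 0 ≤ b := by
    obtain ⟨i⟩ := ‹Nonempty ι›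
    obtain ⟨z, hz⟩ := (hQC i).exists
    exact (spoPlus_nonneg (hS i) (hw i) _ _).trans (hb i g₀ hg₀ z.1 z.2 hz)
  have hD0 : 0 ≤ D := by
    obtain ⟨i⟩ := ‹Nonempty ι›
    exact Metric.diam_nonneg.trans (hD i)
  -- The bound `b` on the loss is available only for costs in `C`, that is almost surely, while the
  -- concentration theorem needs it everywhere. Truncation at `b` keeps the Lipschitz constant and
  -- changes no risk.
  let F : ι → T → X × Vec d → ℝ := fun i t z =>
    min (spoPlus (S i) (w i) ((t : X → Vec d) z.1) z.2) b
  have hFeq : ∀ i t (z : X × Vec d), z.2 ∈ C →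
      F i t z = spoPlus (S i) (w i) ((t : X → Vec d) z.1) z.2 := fun i t z hz =>
    min_eq_left (hb i t (hTH t.2) z.1 z.2 hz)
  have hrisk : ∀ i (t : T), ∫ y, F i t y ∂(Q i) = risk (S i) (w i) (Q i) t := fun i t =>
    integral_congr_ae ((hQC i).mono fun z hz => hFeq i t z hz)
  have hdev := measureReal_deviation_le (Q := Q) (F := F) (b := b) (B := B) (L := 2 * D)
    (V := fun (t : T) z => (t : X → Vec d) z.1)
    (fun i t => (measurable_spoPlus (hS i) (hne i) (hw i) (hwm i)
      ((hTm t t.2).comp measurable_fst) measurable_snd).min measurable_const)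
    (fun i t z => le_min (spoPlus_nonneg (hS i) (hw i) _ _) hb0) (fun i t z => min_le_right _ _)
    (fun t => (hTm t t.2).comp measurable_fst) (fun t z => hB t (hTH t.2) _) (by positivity)
    (fun i t s z => by
      refine (abs_min_sub_min_le_max _ _ _ _).trans ?_
      rw [sub_self, abs_zero, max_eq_left (abs_nonneg _)]
      refine (abs_spoPlus_sub_le (hS i) (hne i) (hw i) _ _ _).trans ?_
      gcongr
      exact hD i)
    ⟨g₀, hgT⟩ hδ hδ1
  have hn : (0 : ℝ) < Fintype.card ι := by exact_mod_cast Fintype.card_pos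
  have hrad := rademacher_fst_eq (Q := Q) hTm hTH hTc ⟨g₀, hgT⟩ hlim hB
  have hlog : 0 < Real.log (1 / δ) := Real.log_pos (one_lt_one_div hδ hδ1)
  have hsqrt : √(2 * Real.log (1 / δ) * Fintype.card ι)
      = Fintype.card ι * √(2 * Real.log (1 / δ) / Fintype.card ι) := by
    rw [← Real.sqrt_sq hn.le, ← Real.sqrt_mul (by positivity), Real.sqrt_sq hn.le]
    congr 1; field_simp
  set R := ∫ z, mean (fun ε : ι → Fin d → ℤˣ =>
    ⨆ t : T, ∑ i, ∑ k, ((ε i k : ℤ) : ℝ) * (t : X → Vec d) (z i).1 k) ∂(Measure.pi Q)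
  have hbound : 4 * √2 * (2 * D) * R + 2 * b * √(2 * Real.log (1 / δ) * Fintype.card ι)
      = Fintype.card ι * (2 * (4 * √2 * D * rademacher (fun i => (Q i).fst) H
          + b * √(2 * Real.log (1 / δ) / Fintype.card ι))) := by
    rw [hrad, hsqrt]; field_simp
  rw [hbound] at hdev
  let bad : Set (ι → X × Vec d) := {z |
    Fintype.card ι * (2 * (4 * √2 * D * rademacher (fun i => (Q i).fst) H
      + b * √(2 * Real.log (1 / δ) / Fintype.card ι)))
    < ⨆ t, (∑ i, (∫ y, F i t y ∂(Q i) - F i t (z i))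
      - ∑ i, (∫ y, F i ⟨g₀, hgT⟩ y ∂(Q i) - F i ⟨g₀, hgT⟩ (z i)))}
  refine ⟨(toMeasurable (Measure.pi Q) bad)ᶜ, (measurableSet_toMeasurable _ _).compl, ?_, fun z hz hzC g hg => ?_⟩
  · rw [compl_compl, measureReal_def, measure_toMeasurable]; exact hdev
  have hzT : ∀ t ∈ T,
      ∑ i, (risk (S i) (w i) (Q i) t - spoPlus (S i) (w i) (t (z i).1) (z i).2)
        - ∑ i, (risk (S i) (w i) (Q i) g₀ - spoPlus (S i) (w i) (g₀ (z i).1) (z i).2)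
      ≤ Fintype.card ι * (2 * (4 * √2 * D * rademacher (fun i => (Q i).fst) H
          + b * √(2 * Real.log (1 / δ) / Fintype.card ι))) := by
    intro t ht
    have h1 : z ∉ bad := fun h => hz (subset_toMeasurable _ _ h)
    simp only [bad, Set.mem_ofPred_eq, not_lt] at h1
    have hFabs : ∀ i t z, |F i t z| ≤ b := fun i t z => by
      rw [abs_of_nonneg (le_min (spoPlus_nonneg (hS i) (hw i) _ _) hb0)]
      exact min_le_right _ _
    have hS' : ∀ t, |∑ i, (∫ y, F i t y ∂(Q i) - F i t (z i))| ≤ Fintype.card ι * (b + b) :=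
      fun t => abs_sum_le_card_mul fun i => (abs_sub _ _).trans
        (add_le_add (abs_integral_le_of_bound (hFabs i t)) (hFabs _ _ _))
    have h2 := (le_ciSup (bddAbove_range_of_abs_le fun t : T =>
      (abs_sub _ _).trans (add_le_add (hS' t) (hS' ⟨g₀, hgT⟩))) ⟨t, ht⟩).trans h1
    simpa only [hrisk, hFeq _ _ _ (hzC _)] using h2
  -- Passage from `T` to `H`: along a pointwise convergent sequence the losses converge by Lipschitz
  -- continuity and the risks by dominated convergence.
  obtain ⟨u, hu, hux⟩ := hlim g hg
  have ht : Tendsto (fun r =>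
      ∑ i, (risk (S i) (w i) (Q i) (u r) - spoPlus (S i) (w i) (u r (z i).1) (z i).2)
        - ∑ i, (risk (S i) (w i) (Q i) g₀ - spoPlus (S i) (w i) (g₀ (z i).1) (z i).2)) atTop
      (𝓝 (∑ i, (risk (S i) (w i) (Q i) g - spoPlus (S i) (w i) (g (z i).1) (z i).2)
        - ∑ i, (risk (S i) (w i) (Q i) g₀ - spoPlus (S i) (w i) (g₀ (z i).1) (z i).2))) :=
    (tendsto_finsetSum _ fun i _ => (tendsto_risk (hS i) (hne i) (hw i) (hwm i) (hQC i)
      (fun r => hTm _ (hu r)) (fun r => hb i _ (hTH (hu r))) hux).sub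
        (tendsto_spoPlus (hS i) (hne i) (hw i) (hux _))).sub tendsto_const_nhds
  exact le_of_tendsto' ht fun r => hzT (u r) (hu r)

/-- All risks are bounded by `b`, so the supremum defining the discrepancy runs over a bounded
family and dominates each member. -/
lemma abs_risk_sub_mixRisk_le_discrepancy {m : ℕ} {S : Fin m → Set (Vec d)}
    {w : Fin m → Vec d → Vec d} {P : Fin m → Measure (X × Vec d)}
    [∀ k, IsProbabilityMeasure (P k)] (hS : ∀ k, IsCompact (S k))
    (hw : ∀ k, IsOracle (S k) (w k)) (hPC : ∀ k, ∀ᵐ z ∂(P k), z.2 ∈ C)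
    (hb : ∀ k, ∀ g ∈ H, ∀ x, ∀ c ∈ C, spoPlus (S k) (w k) (g x) c ≤ b) (n : Fin m → ℕ)
    (j : Fin m) {g : X → Vec d} (hg : g ∈ H) :
    |risk (S j) (w j) (P j) g - mixRisk S w P n g| ≤ discrepancy S w P n H j := by
  have hr : ∀ k, ∀ g ∈ H, |risk (S k) (w k) (P k) g| ≤ b := by
    intro k g hg
    have := norm_integral_le_of_norm_le_const (μ := P k) (C := b)
      (f := fun z : X × Vec d => spoPlus (S k) (w k) (g z.1) z.2) <| by
        filter_upwards [hPC k] with z hz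
        rw [Real.norm_of_nonneg (spoPlus_nonneg (hS k) (hw k) _ _)]
        exact hb k g hg z.1 z.2 hz
    simpa [risk] using this
  refine le_ciSup (f := fun g : H => |risk (S j) (w j) (P j) g - mixRisk S w P n g|)
    ⟨b + ∑ k, ((n k : ℝ) / totalSize n) * b, ?_⟩ ⟨g, hg⟩
  rintro _ ⟨g', rfl⟩
  refine (abs_sub _ _).trans (add_le_add (hr j g' g'.2) ?_)
  refine (Finset.abs_sum_le_sum_abs _ _).trans (Finset.sum_le_sum fun k _ => ?_)
  rw [abs_mul, abs_of_nonneg (by positivity)]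
  exact mul_le_mul_of_nonneg_left (hr k g' g'.2) (by positivity)

end Deviation

/-! ### Transfer to the sample space and the federation gain bound -/

/-- The joint law of independent samples is the product of their laws. -/
lemma measureReal_preimage_eq_pi {ι Ω Y : Type*} [Fintype ι] [MeasurableSpace Ω]
    [MeasurableSpace Y] {μ : Measure Ω} {Z : ι → Ω → Y} {Q : ι → Measure Y}
    (hlaw : ∀ i, HasLaw (Z i) (Q i) μ) (hindep : iIndepFun Z μ) {E : Set (ι → Y)}
    (hE : MeasurableSet E) :
    μ.real {ω | (fun i => Z i ω) ∈ E} = (Measure.pi Q).real E := by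
  have hμ := hindep.isProbabilityMeasure
  have h := (iIndepFun_iff_map_fun_eq_pi_map fun i => (hlaw i).aemeasurable).1 hindep
  simp only [(hlaw _).map_eq] at h
  rw [← h, map_measureReal_apply_of_aemeasurable
    (aemeasurable_pi_lambda _ fun i => (hlaw i).aemeasurable) hE]
  rfl

end FedSPO

theorem mainTheorem3 {d m : ℕ} {X : Type*} [MeasurableSpace X]
    -- feasible sets and oracles of the clients
    (S : Fin m → Set (FedSPO.Vec d)) (hS_ne : ∀ k, (S k).Nonempty) (hS : ∀ k, IsCompact (S k))
    (w : Fin m → FedSPO.Vec d → FedSPO.Vec d) (hw : ∀ k, FedSPO.IsOracle (S k) (w k))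
    (hw_meas : ∀ k, Measurable (w k))
    -- distributions of the clients; cost vectors lie in a bounded set
    (P : Fin m → Measure (X × FedSPO.Vec d)) [∀ k, IsProbabilityMeasure (P k)]
    (C : Set (FedSPO.Vec d)) (Cmax : ℝ) (hC : ∀ c ∈ C, ‖c‖ ≤ Cmax)
    (hPC : ∀ k, ∀ᵐ z ∂(P k), z.2 ∈ C)
    -- hypothesis class with bounded outputs
    (H : Set (X → FedSPO.Vec d)) (hH : FedSPO.PointwiseMeasurable H)
    (B : ℝ) (hB : ∀ g ∈ H, ∀ x, ‖g x‖ ≤ B)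
    -- the data: client `k` holds `n k` samples from `P k`, all samples are independent
    (n : Fin m → ℕ) {Ω : Type*} [MeasurableSpace Ω] (μ : Measure Ω) [IsProbabilityMeasure μ]
    (Z : (k : Fin m) → Fin (n k) → Ω → X × FedSPO.Vec d)
    (hZ_law : ∀ k i, HasLaw (Z k i) (P k) μ)
    (hZ_indep : iIndepFun (fun (p : Σ k : Fin m, Fin (n k)) => Z p.1 p.2) μ)
    -- the client, its optimal predictor and the confidence level
    (j : Fin m) (hn : 0 < n j)
    (gstar : X → FedSPO.Vec d) (hgstar : gstar ∈ H)
    (hgstar_min : IsMinOn (FedSPO.risk (S j) (w j) (P j)) H gstar)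
    (δ : ℝ) (hδ : 0 < δ) (hδ_lt : δ < 1) :
    ∃ A : Set Ω, MeasurableSet A ∧ 1 - δ ≤ μ.real A ∧ ∀ ω ∈ A,
      (∀ gloc ∈ H, IsMinOn (FedSPO.empRisk (S j) (w j) (fun i => Z j i ω)) H gloc →
        FedSPO.risk (S j) (w j) (P j) gloc - FedSPO.risk (S j) (w j) (P j) gstar
          ≤ 2 * FedSPO.localEps (S j) (w j) (P j) H C (n j) (δ / 2)) ∧
      (∀ gfed ∈ H, IsMinOn (FedSPO.mixEmpRisk S w (fun k i => Z k i ω)) H gfed →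
        FedSPO.risk (S j) (w j) (P j) gfed - FedSPO.risk (S j) (w j) (P j) gstar
          ≤ 2 * FedSPO.mixEps S w P H C n (δ / 2)
            + 2 * FedSPO.discrepancy S w P n H j) := by
  have hb : ∀ k, ∀ g ∈ H, ∀ x, ∀ c ∈ C,
      FedSPO.spoPlus (S k) (w k) (g x) c ≤ FedSPO.lossBound (S k) (w k) H C :=
    fun k g hg x c hc => FedSPO.spoPlus_le_lossBound (hS k) (hS_ne k) (hw k) hB hC hg x hc
  have hbmax : ∀ k, ∀ g ∈ H, ∀ x, ∀ c ∈ C,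
      FedSPO.spoPlus (S k) (w k) (g x) c ≤ ⨆ k, FedSPO.lossBound (S k) (w k) H C :=
    fun k g hg x c hc => (hb k g hg x c hc).trans
      (le_ciSup (f := fun k => FedSPO.lossBound (S k) (w k) H C) (Finite.bddAbove_range _) k)
  have hDmax : ∀ k, Metric.diam (S k) ≤ ⨆ k, Metric.diam (S k) := fun k =>
    le_ciSup (f := fun k => Metric.diam (S k)) (Finite.bddAbove_range _) k
  have hδ2 : 0 < δ / 2 := by positivity
  have hδ2' : δ / 2 < 1 := by linarith
  have hnj : (0 : ℝ) < n j := by exact_mod_cast hn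
  have hN : (0 : ℝ) < FedSPO.totalSize n := by
    exact_mod_cast hn.trans_le (Finset.single_le_sum (f := n) (fun _ _ => Nat.zero_le _)
      (Finset.mem_univ j))
  have : Nonempty (Fin (n j)) := ⟨⟨0, hn⟩⟩
  have : Nonempty (Σ k : Fin m, Fin (n k)) := ⟨⟨j, ⟨0, hn⟩⟩⟩
  obtain ⟨E₁, hE₁, hE₁δ, hloc⟩ := FedSPO.exists_uniform_deviation_event (ι := Fin (n j))
    (S := fun _ => S j) (w := fun _ => w j) (Q := fun _ => P j) (fun _ => hS j) (fun _ => hS_ne j)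
    (fun _ => hw j) (fun _ => hw_meas j) (fun _ => hPC j) hH hB (fun _ => le_rfl) (fun _ => hb j)
    hgstar hδ2 hδ2'
  obtain ⟨E₂, hE₂, hE₂δ, hmix⟩ := FedSPO.exists_uniform_deviation_event
    (ι := Σ k : Fin m, Fin (n k)) (S := fun p => S p.1) (w := fun p => w p.1)
    (Q := fun p => P p.1) (fun _ => hS _) (fun _ => hS_ne _) (fun _ => hw _)
    (fun _ => hw_meas _) (fun _ => hPC _) hH hB (fun p => hDmax p.1) (fun p => hbmax p.1)
    hgstar hδ2 hδ2'
  have h₁ := FedSPO.measureReal_preimage_eq_pi (Z := fun i : Fin (n j) => Z j i)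
    (fun i => hZ_law j i) (hZ_indep.precomp (g := Sigma.mk (β := fun k => Fin (n k)) j)
      sigma_mk_injective) hE₁.compl
  have h₂ := FedSPO.measureReal_preimage_eq_pi
    (Z := fun p : (Σ k : Fin m, Fin (n k)) => Z p.1 p.2) (fun p => hZ_law p.1 p.2) hZ_indep
    hE₂.compl
  have h₀ : ∀ᵐ ω ∂μ, ∀ k i, (Z k i ω).2 ∈ C := ae_all_iff.2 fun k => ae_all_iff.2 fun i =>
    ae_of_ae_map (hZ_law k i).aemeasurable (by rw [(hZ_law k i).map_eq]; exact hPC k)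
  -- A null set where some cost leaves `C`, and two failure events of probability at most `δ/2`
  -- each. The good event is the complement of a measurable hull, since `C` need not be measurable.
  set bad : Set Ω := {ω | ¬ ∀ k i, (Z k i ω).2 ∈ C} ∪
    ({ω | (fun i => Z j i ω) ∈ E₁ᶜ} ∪
      {ω | (fun p : (Σ k : Fin m, Fin (n k)) => Z p.1 p.2 ω) ∈ E₂ᶜ}) with hbad
  have hbadδ : μ.real bad ≤ δ := by
    refine (measureReal_union_le _ _).trans ?_
    have e₀ : μ.real {ω | ¬ ∀ k i, (Z k i ω).2 ∈ C} = 0 := by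
      rw [measureReal_def, ae_iff.1 h₀, ENNReal.toReal_zero]
    rw [e₀]
    have := measureReal_union_le (μ := μ) {ω | (fun i => Z j i ω) ∈ E₁ᶜ}
      {ω | (fun p : (Σ k : Fin m, Fin (n k)) => Z p.1 p.2 ω) ∈ E₂ᶜ}
    rw [h₁, h₂] at this
    linarith
  refine ⟨(toMeasurable μ bad)ᶜ, (measurableSet_toMeasurable _ _).compl, ?_, fun ω hω => ?_⟩
  · rw [probReal_compl_eq_one_sub (measurableSet_toMeasurable _ _), measureReal_def,
      measure_toMeasurable, ← measureReal_def]
    linarith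
  have hω' : ω ∉ bad := fun h => hω (subset_toMeasurable _ _ h)
  simp only [hbad, Set.mem_union, Set.mem_ofPred_eq, not_or, not_not, Set.mem_compl_iff] at hω'
  obtain ⟨hωC, hω₁, hω₂⟩ := hω'
  refine ⟨fun g hg hmin => ?_, fun g hg hmin => ?_⟩
  · have hdev := hloc _ hω₁ (fun i => hωC j i) g hg
    have hle : FedSPO.empRisk (S j) (w j) (fun i => Z j i ω) g
        ≤ FedSPO.empRisk (S j) (w j) (fun i => Z j i ω) gstar := hmin hgstar
    have hle' := le_of_mul_le_mul_left hle (by positivity)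
    simp only [Finset.sum_sub_distrib, Finset.sum_const, Finset.card_univ, Fintype.card_fin,
      nsmul_eq_mul] at hdev
    refine le_of_mul_le_mul_left (a := (n j : ℝ)) ?_ hnj
    refine le_trans ?_ hdev
    linarith
  · have hdev := hmix _ hω₂ (fun p => hωC p.1 p.2) g hg
    have hcard : Fintype.card (Σ k : Fin m, Fin (n k)) = FedSPO.totalSize n := by
      simp [FedSPO.totalSize]
    have hle : FedSPO.mixEmpRisk S w (fun k i => Z k i ω) g
        ≤ FedSPO.mixEmpRisk S w (fun k i => Z k i ω) gstar := hmin hgstar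
    have hle' := le_of_mul_le_mul_left hle (by positivity)
    -- Weighting every pooled sample equally weights client `k` by `n k`, so the pooled sum of risks
    -- is `N` times the mixture risk.
    have hsum : ∀ g : X → FedSPO.Vec d, ∑ k, (n k : ℝ) * FedSPO.risk (S k) (w k) (P k) g
        = FedSPO.totalSize n * FedSPO.mixRisk S w P n g := by
      intro g
      rw [FedSPO.mixRisk, Finset.mul_sum]
      refine Finset.sum_congr rfl fun k _ => ?_
      field_simp
    rw [hcard] at hdev
    simp only [Finset.sum_sub_distrib, Fintype.sum_sigma, Finset.sum_const, Finset.card_univ,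
      Fintype.card_fin, nsmul_eq_mul, hsum] at hdev
    have hmixle : FedSPO.mixRisk S w P n g - FedSPO.mixRisk S w P n gstar
        ≤ 2 * FedSPO.mixEps S w P H C n (δ / 2) := by
      refine le_of_mul_le_mul_left (a := (FedSPO.totalSize n : ℝ)) ?_ hN
      refine le_trans ?_ hdev
      linarith
    -- The discrepancy is paid once at the federated predictor and once at `gstar`, giving `2Δ_j`.
    have d₁ := abs_le.1 (FedSPO.abs_risk_sub_mixRisk_le_discrepancy hS hw hPC hbmax n j hg)
    have d₂ := abs_le.1 (FedSPO.abs_risk_sub_mixRisk_le_discrepancy hS hw hPC hbmax n j hgstar)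
    linarith [d₁.2, d₂.1]
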